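/- Let $K/k$ be a finite Galois extension of global fields with Galois group $G$ (not necessarily cyclic). Let $S$ be a finite non-empty set of places of $k$ containing all archimedean places, let $\mathcal O_{k,S}$ be the ring of $S$-integers of $k$, and let $\mathfrak m=\mathfrak m_f\mathfrak m_\infty$ be a modulus of $k$ whose finite part is prime to $S$: $\mathfrak m_f$ is a nonzero ideal of $\mathcal O_{k,S}$, and $\mathfrak m_\infty$ is a formal product of distinct real places of $k$ (empty in the function field case). Let $S(\mathfrak m)$ be the set of places of $k$ dividing $\mathfrak m$. For a global field $F$, a finite non-empty set $S$ of places of $F$ containing the archimedean ones, and such a modulus $\mathfrak m$ of $F$, let $F^{\mathfrak m}$ be the group of all $x\in F^\times$ with $x\in 1+\mathfrak m_f\mathcal O_w$ for every finite place $w\mid\mathfrak m_f$ and $w(x)>0$ for every real place $w\mid\mathfrak m_\infty$. Let $E^{\mathfrak m}_{F,S}=\mathcal O_{F,S}^\times\cap F^{\mathfrak m}$, and let $$\mathrm{Cl}^{\mathfrak m}_{F,S}=I_F^{S(\mathfrak m)\cup S}\big/\Big\{\textstyle\sum_{w\notin S}\mathrm{ord}_w(x)\,w : x\in F^{\mathfrak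 m}\Big\},$$ where $I_F^{S(\mathfrak m)\cup S}$ is the free abelian group on the finite places of $F$ outside $S\cup S(\mathfrak m)$. Let $S_K$ be the set of places of $K$ over $S$, and let $\mathfrak m_K$ be the modulus of $K$ with finite part $\mathfrak m_f\mathcal O_{K,S_K}$ and infinite part the product of the real places of $K$ lying over places dividing $\mathfrak m_\infty$. Write $K^{\mathfrak m}$, $E^{\mathfrak m}_{K,S}$, $\mathrm{Cl}^{\mathfrak m}_{K,S}$ for $K^{\mathfrak m_K}$, $E^{\mathfrak m_K}_{K,S_K}$, $\mathrm{Cl}^{\mathfrak m_K}_{K,S_K}$; these are $G$-modules. Let $\mathfrak m_r$ be the modulus of $k$ obtained from $\mathfrak m$ by keeping $\mathfrak m_f$ and only those real places dividing $\mathfrak m_\infty$ that stay real in $K$. For a finite place $v$ of $k$ let $e_v$ be its ramification index in $K/k$. Then the groups $\mathrm{Cl}^{\mathfrak m}_{K,S}$, $\mathrm{Cl}^{\mathfrak m_r}_{k,S}$, $H^1(G,E^{\mathfrak m}_{K,S})$, $H^2(G,E^{\mathfrak m}_{K,S})$ and $H^1(G,K^{\mathfrak m})$ are finite, $e_v=1$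 for all but finitely many $v\notin S\cup S(\mathfrak m)$, and $$\frac{|(\mathrm{Cl}^{\mathfrak m}_{K,S})^G|}{|\mathrm{Cl}^{\mathfrak m_r}_{k,S}|} =\frac{|H^2(G,E^{\mathfrak m}_{K,S})|}{|H^1(G,E^{\mathfrak m}_{K,S})|}\cdot \frac{\prod_{v\notin S\cup S(\mathfrak m)}e_v\cdot|H^1(G,K^{\mathfrak m})|}{\big|\mathrm{Im}\{H^2(G,E^{\mathfrak m}_{K,S})\to H^2(G,K^{\mathfrak m})\}\big|},$$ where the map on $H^2$ is induced by the inclusion $E^{\mathfrak m}_{K,S}\subset K^{\mathfrak m}$. -/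

import Mathlib

open scoped Pointwise

noncomputable section

namespace RayClass

/-- A global field: a number field, or a finite extension of `𝔽_p(t)` for some prime `p`. -/
def IsGlobalField (F : Type*) [Field F] : Prop :=
  NumberField F ∨
    ∃ (p : ℕ) (_ : Fact p.Prime) (_ : Algebra (RatFunc (ZMod p)) F),
      FiniteDimensional (RatFunc (ZMod p)) F

/-! ### Places -/

/-- A finite (non-archimedean) place of `F`, given by its valuation ring in `F`, which is a
discrete valuation ring with field of fractions `F`. -/
@[ext]
structure FinitePlace (F : Type*) [Field F] where
  /-- the valuation ring of the place -/
  ring : ValuationSubring F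
  isDVR : IsDiscreteValuationRing ring

attribute [instance] FinitePlace.isDVR

/-- The places of `F`: the finite ones and the archimedean ones. -/
abbrev Place (F : Type*) [Field F] : Type _ :=
  FinitePlace F ⊕ NumberField.InfinitePlace F

/-- The normalized additive valuation `ord_w : Fˣ → ℤ` of a finite place, written as a
homomorphism to `Multiplicative ℤ`; it is `1` on uniformizers. (Mathlib's `valuationOfNeZero` is
the inverse of it: it is `-1` on uniformizers.) -/
def FinitePlace.ordHom {F : Type*} [Field F] (w : FinitePlace F) : Fˣ →* Multiplicative ℤ :=
  ((IsDiscreteValuationRing.maximalIdeal w.ring).valuationOfNeZero)⁻¹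

/-- The normalized additive valuation `ord_w(x) ∈ ℤ` of a nonzero element `x`. -/
def FinitePlace.ord {F : Type*} [Field F] (w : FinitePlace F) (x : Fˣ) : ℤ :=
  (w.ordHom x).toAdd

/-! ### `S`-integers and `S`-moduli -/

section SModulus

variable {F : Type*} [Field F]

/-- The ring `O_{F,S}` of `S`-integers: the elements that lie in `O_w` for all finite `w ∉ S`
(`S` is always a set of places that contains the archimedean ones). -/
def sIntegers (S : Set (Place F)) : Subring F where
  carrier := {a | ∀ w : FinitePlace F, Sum.inl w ∉ S → a ∈ w.ring}
  mul_mem' ha hb w hw := mul_mem (ha w hw) (hb w hw)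
  one_mem' w _ := one_mem w.ring
  add_mem' ha hb w hw := add_mem (ha w hw) (hb w hw)
  zero_mem' w _ := zero_mem w.ring
  neg_mem' ha w hw := neg_mem (ha w hw)

/-- The group of `S`-units: the nonzero `x` with both `x` and `x⁻¹` in `O_{F,S}`. -/
def sUnits (S : Set (Place F)) : Subgroup Fˣ where
  carrier := {x | (x : F) ∈ sIntegers S ∧ ((x⁻¹ : Fˣ) : F) ∈ sIntegers S}
  mul_mem' {x y} hx hy := by
    refine ⟨?_, ?_⟩
    · rw [Units.val_mul]; exact mul_mem hx.1 hy.1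
    · rw [mul_inv, Units.val_mul]; exact mul_mem hx.2 hy.2
  one_mem' := by
    refine ⟨?_, ?_⟩
    · rw [Units.val_one]; exact one_mem _
    · rw [inv_one, Units.val_one]; exact one_mem _
  inv_mem' {x} hx := ⟨hx.2, by rw [inv_inv]; exact hx.1⟩

/-- An `S`-modulus `𝔪 = 𝔪_∞ 𝔪_f`: a nonzero ideal `𝔪_f` of `O_{F,S}` together with a set of
real places. -/
structure SModulus (S : Set (Place F)) where
  /-- the finite part `𝔪_f` -/
  fin : Ideal (sIntegers S)
  fin_ne_bot : fin ≠ ⊥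
  /-- the real places that divide `𝔪_∞` -/
  inf : Set (NumberField.InfinitePlace F)
  isReal : ∀ w ∈ inf, w.IsReal

namespace SModulus

variable {S : Set (Place F)} (m : SModulus S)

/-- The finite place `w` divides `𝔪_f`: it is outside `S`, and `𝔪_f` is contained in the maximal
ideal of `O_w`. -/
def FinDvd (w : FinitePlace F) : Prop :=
  Sum.inl w ∉ S ∧ ∀ a ∈ m.fin, (a : F) ∈ w.ring.nonunits

/-- The support `S(𝔪)` of the modulus. -/
def support : Set (Place F) :=
  {w | Sum.elim m.FinDvd (fun w => w ∈ m.inf) w}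

/-- The ideal `𝔪_f O_w`, as an `O_w`-submodule of `F`. -/
def localIdeal (w : FinitePlace F) : Submodule w.ring F :=
  Submodule.span w.ring (Subtype.val '' (m.fin : Set (sIntegers S)))

theorem localIdeal_le {w : FinitePlace F} (hw : m.FinDvd w) {x : F} (hx : x ∈ m.localIdeal w) :
    x ∈ w.ring.nonunits := by
  rw [ValuationSubring.mem_nonunits_iff]
  induction hx using Submodule.span_induction with
  | mem x hx =>
    obtain ⟨a, ha, rfl⟩ := hx
    exact (ValuationSubring.mem_nonunits_iff _).1 (hw.2 a ha)
  | zero => simp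
  | add x y _ _ hx hy => exact Valuation.map_add_lt _ hx hy
  | smul a x _ hx =>
    have ha : w.ring.valuation (a : F) ≤ 1 := (ValuationSubring.valuation_le_one_iff _ _).2 a.2
    rw [show a • x = (a : F) * x from rfl, map_mul]
    exact mul_lt_one_of_nonneg_of_lt_one_right ha zero_le hx

theorem mem_ring_of_sub_one_mem {w : FinitePlace F} (hw : m.FinDvd w) {x : F}
    (hx : x - 1 ∈ m.localIdeal w) : x ∈ w.ring := by
  have := add_mem (w.ring.nonunits_subset (m.localIdeal_le hw hx)) (one_mem w.ring)
  rwa [sub_add_cancel] at this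

theorem inv_mem_ring_of_sub_one_mem {w : FinitePlace F} (hw : m.FinDvd w) {x : F}
    (hx : x - 1 ∈ m.localIdeal w) : x⁻¹ ∈ w.ring := by
  have h := (ValuationSubring.mem_nonunits_iff _).1 (m.localIdeal_le hw hx)
  have h1 : w.ring.valuation x = 1 := by
    have := Valuation.map_one_add_of_lt w.ring.valuation h
    rwa [add_sub_cancel] at this
  rw [← ValuationSubring.valuation_le_one_iff, map_inv₀, h1, inv_one]

/-- The group `F^𝔪` of the `x ∈ Fˣ` with `x ≡ 1 mod 𝔪_f`, that is `x ∈ 1 + 𝔪_f O_w` for all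
`w ∣ 𝔪_f`, and `w(x) > 0` for each real place `w ∣ 𝔪_∞`. -/
def rayGroup : Subgroup Fˣ where
  carrier := {x | (∀ w, m.FinDvd w → (x : F) - 1 ∈ m.localIdeal w) ∧
    ∀ (w : NumberField.InfinitePlace F) (hw : w ∈ m.inf),
      0 < NumberField.InfinitePlace.embedding_of_isReal (m.isReal w hw) (x : F)}
  one_mem' := ⟨fun w _ => by simp, fun w hw => by simp⟩
  mul_mem' {x y} hx hy := by
    refine ⟨fun w hw => ?_, fun w hw => ?_⟩
    · have h : ((x * y : Fˣ) : F) - 1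
          = (⟨x, m.mem_ring_of_sub_one_mem hw (hx.1 w hw)⟩ : w.ring) • ((y : F) - 1)
            + ((x : F) - 1) := by
        rw [show ∀ (a : w.ring) (z : F), a • z = (a : F) * z from fun _ _ => rfl]
        push_cast
        ring
      rw [h]
      exact add_mem (Submodule.smul_mem _ _ (hy.1 w hw)) (hx.1 w hw)
    · rw [Units.val_mul, map_mul]
      exact mul_pos (hx.2 w hw) (hy.2 w hw)
  inv_mem' {x} hx := by
    refine ⟨fun w hw => ?_, fun w hw => ?_⟩
    · have h : ((x⁻¹ : Fˣ) : F) - 1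
          = -((⟨(x : F)⁻¹, m.inv_mem_ring_of_sub_one_mem hw (hx.1 w hw)⟩ : w.ring)
            • ((x : F) - 1)) := by
        rw [show ∀ (a : w.ring) (z : F), a • z = (a : F) * z from fun _ _ => rfl]
        have := x.ne_zero
        push_cast
        field_simp
        ring
      rw [h]
      exact neg_mem (Submodule.smul_mem _ _ (hx.1 w hw))
    · rw [Units.val_inv_eq_inv_val, map_inv₀]
      exact inv_pos.2 (hx.2 w hw)

/-- The group `E^𝔪_{F,S}`: the `S`-units that lie in `F^𝔪`. -/
def unitGroup : Subgroup Fˣ := sUnits S ⊓ m.rayGroup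

/-- The group `I_F^{S(𝔪) ∪ S}`: the free abelian group on the finite places outside
`S ∪ S(𝔪)`, as a subgroup of the group of all divisors. -/
def divisorGroup : AddSubgroup (FinitePlace F →₀ ℤ) where
  carrier := {D | ∀ w : FinitePlace F, Sum.inl w ∈ S ∪ m.support → D w = 0}
  add_mem' ha hb w hw := by rw [Finsupp.add_apply, ha w hw, hb w hw, add_zero]
  zero_mem' _ _ := rfl
  neg_mem' ha w hw := by rw [Finsupp.neg_apply, ha w hw, neg_zero]

/-- The group `P_F^{𝔪,S}` of the principal divisors `div^S(x) = ∑_{w ∉ S} ord_w(x) w` with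
`x ∈ F^𝔪`, as a subgroup of `I_F^{S(𝔪) ∪ S}`. -/
def principalDivisors : AddSubgroup m.divisorGroup where
  carrier := {D | ∃ x ∈ m.rayGroup, ∀ w : FinitePlace F, Sum.inl w ∉ S → D.1 w = w.ord x}
  add_mem' := by
    rintro a b ⟨x, hx, hax⟩ ⟨y, hy, hby⟩
    refine ⟨x * y, mul_mem hx hy, fun w hw => ?_⟩
    simp [FinitePlace.ord, hax w hw, hby w hw]
  zero_mem' := ⟨1, one_mem _, fun w _ => by simp [FinitePlace.ord]⟩
  neg_mem' := by
    rintro a ⟨x, hx, hax⟩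
    exact ⟨x⁻¹, inv_mem hx, fun w hw => by simp [FinitePlace.ord, hax w hw]⟩

/-- The `S`-ray class group `Cl^𝔪_{F,S} = I_F^{S(𝔪) ∪ S} / P_F^{𝔪,S}`. -/
abbrev ClassGroup : Type _ := m.divisorGroup ⧸ m.principalDivisors

end SModulus

end SModulus

/-! ### Extensions -/

section Extension

variable {k K : Type*} [Field k] [Field K] [Algebra k K]

/-- The place `w` of `K` lies over the place `v` of `k`. -/
def LiesOver : Place K → Place k → Prop
  | Sum.inl w, Sum.inl v => w.ring.comap (algebraMap k K) = v.ring
  | Sum.inr w, Sum.inr v => w.comap (algebraMap k K) = v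
  | _, _ => False

variable (K) in
/-- The set `S_K` of the places of `K` over `S`. -/
def placesOver (S : Set (Place k)) : Set (Place K) :=
  {w | ∃ v ∈ S, LiesOver w v}

variable (k) in
/-- The ramification index over `k` of a finite place `w` of `K`: the index of the value group
`ord_w(kˣ)` in `ord_w(Kˣ) = ℤ`. -/
def ramificationIndexAt (w : FinitePlace K) : ℕ :=
  (w.ordHom.comp (Units.map (algebraMap k K : k →* K))).range.index

open Classical in
variable (K) in
/-- The ramification index `e_v` in `K/k` of a finite place `v` of `k`: the ramification index of
some place `w` of `K` over `v`. (In a finite extension there always is such a `w`, and in a Galois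
extension `e_v` does not depend on it.) -/
def ramificationIndex (v : FinitePlace k) : ℕ :=
  if h : ∃ w : FinitePlace K, LiesOver (Sum.inl w) (Sum.inl v) then
    ramificationIndexAt k h.choose
  else 1

theorem FinitePlace.valuation_le_one_iff {F : Type*} [Field F] (w : FinitePlace F) (x : F) :
    (IsDiscreteValuationRing.maximalIdeal w.ring).valuation F x ≤ 1 ↔ x ∈ w.ring := by
  constructor
  · intro h
    obtain ⟨a, rfl⟩ := IsDiscreteValuationRing.exists_lift_of_le_one h
    exact a.2
  · intro h
    exact (IsDiscreteValuationRing.maximalIdeal w.ring).valuation_le_one (⟨x, h⟩ : w.ring)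

/-- The restriction to `k` of a finite place of `K` is a finite place or trivial. -/
theorem FinitePlace.isDVR_comap (w : FinitePlace K) {a : k}
    (ha : algebraMap k K a ∉ w.ring) :
    IsDiscreteValuationRing (w.ring.comap (algebraMap k K)) := by
  set v := ((IsDiscreteValuationRing.maximalIdeal w.ring).valuation K).comap (algebraMap k K)
    with hv
  have hle : ∀ x, v x ≤ 1 ↔ algebraMap k K x ∈ w.ring := fun x => w.valuation_le_one_iff _
  have hcomap : w.ring.comap (algebraMap k K) = v.valuationSubring := by
    ext x
    rw [ValuationSubring.mem_comap, Valuation.mem_valuationSubring_iff, hle]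
  have h1 : ¬ v a ≤ 1 := fun h => ha ((hle a).1 h)
  have h0 : v a ≠ 0 := fun h => h1 (by rw [h]; exact zero_le)
  have : Nontrivial (MonoidWithZeroHom.valueGroup (.ofClass v)) := by
    rw [Subgroup.nontrivial_iff_exists_ne_one]
    refine ⟨Units.mk0 (v a) h0, MonoidWithZeroHom.mem_valueGroup _ ⟨a, rfl⟩, fun h => h1 ?_⟩
    have := congrArg Units.val h
    simp only [Units.val_mk0, Units.val_one] at this
    exact this.le
  rw [hcomap]
  infer_instance

theorem algebraMap_mem_sIntegers {S : Set (Place k)} {a : k} (ha : a ∈ sIntegers S) :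
    algebraMap k K a ∈ sIntegers (placesOver K S) := by
  intro w hw
  by_contra h
  have hv := w.isDVR_comap h
  exact h (ha ⟨w.ring.comap (algebraMap k K), hv⟩ fun hS => hw ⟨_, hS, rfl⟩)

variable (K) in
/-- The inclusion `O_{k,S} → O_{K,S_K}`. -/
def sIntegersMap (S : Set (Place k)) : sIntegers S →+* sIntegers (placesOver K S) :=
  ((algebraMap k K).comp (sIntegers S).subtype).codRestrict _
    fun a => algebraMap_mem_sIntegers a.2

theorem sIntegersMap_injective (S : Set (Place k)) : Function.Injective (sIntegersMap K S) := by
  intro a b h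
  exact Subtype.ext ((algebraMap k K).injective (congrArg Subtype.val h))

variable (K) in
/-- The modulus `𝔪_K` of `K` induced by `𝔪`: its finite part is `𝔪_f O_{K,S}`, its infinite part
consists of the real places of `K` over the places that divide `𝔪_∞`. -/
def SModulus.induced {S : Set (Place k)} (m : SModulus S) : SModulus (placesOver K S) where
  fin := m.fin.map (sIntegersMap K S)
  fin_ne_bot := by
    rw [ne_eq, Ideal.map_eq_bot_iff_of_injective (sIntegersMap_injective S)]
    exact m.fin_ne_bot
  inf := {w | w.IsReal ∧ w.comap (algebraMap k K) ∈ m.inf}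
  isReal _ hw := hw.1

variable (K) in
/-- The modulus `𝔪_r` of `k`: the finite part of `𝔪`, together with the real places dividing
`𝔪_∞` that are unramified in `K`, i.e. that stay real in `K`. -/
def SModulus.unramifiedPart {S : Set (Place k)} (m : SModulus S) : SModulus S where
  fin := m.fin
  fin_ne_bot := m.fin_ne_bot
  inf := {v | v ∈ m.inf ∧ v.IsUnramifiedIn K}
  isReal v hv := m.isReal v hv.1

/-! ### The action of the Galois group -/

/-- The isomorphism from `O_w` to `O_{σ w} = σ O_w`. -/
def ringEquivSMul (σ : K ≃ₐ[k] K) (A : ValuationSubring K) :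
    A ≃+* (σ • A : ValuationSubring K) where
  toFun a := ⟨σ a, ValuationSubring.smul_mem_pointwise_smul σ a.1 A a.2⟩
  invFun a := ⟨σ.symm a, (ValuationSubring.mem_pointwise_smul_iff_inv_smul_mem).1 a.2⟩
  left_inv a := Subtype.ext (σ.symm_apply_apply a.1)
  right_inv a := Subtype.ext (σ.apply_symm_apply a.1)
  map_mul' a b := Subtype.ext (map_mul σ a.1 b.1)
  map_add' a b := Subtype.ext (map_add σ a.1 b.1)

/-- The Galois group acts on the finite places; the valuation ring of `σ w` is `σ O_w`. -/
instance FinitePlace.instMulAction : MulAction (K ≃ₐ[k] K) (FinitePlace K) where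
  smul σ w := ⟨σ • w.ring, IsDiscreteValuationRing.RingEquivClass.isDiscreteValuationRing (ringEquivSMul σ w.ring)⟩
  one_smul w := FinitePlace.ext (one_smul _ w.ring)
  mul_smul σ τ w := FinitePlace.ext (mul_smul σ τ w.ring)

theorem ring_smul (σ : K ≃ₐ[k] K) (w : FinitePlace K) : (σ • w).ring = σ • w.ring := rfl

theorem mem_ring_smul {σ : K ≃ₐ[k] K} {w : FinitePlace K} {x : K} :
    σ x ∈ (σ • w).ring ↔ x ∈ w.ring :=
  ValuationSubring.smul_mem_pointwise_smul_iff (g := σ)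

theorem mem_nonunits_smul {σ : K ≃ₐ[k] K} {w : FinitePlace K} {x : K} :
    σ x ∈ (σ • w).ring.nonunits ↔ x ∈ w.ring.nonunits := by
  rw [ValuationSubring.mem_nonunits_iff_or, ValuationSubring.mem_nonunits_iff_or,
    ← map_inv₀, mem_ring_smul, map_eq_zero]

theorem FinitePlace.ordHom_unit {F : Type*} [Field F] (w : FinitePlace F) (x : Fˣ)
    (u : w.ringˣ) (h : (x : F) = (u : w.ring)) : w.ordHom x = 1 := by
  have : x = Units.map (algebraMap w.ring F : w.ring →* F) u := Units.ext h
  rw [FinitePlace.ordHom, MonoidHom.inv_apply, this,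
    IsDedekindDomain.HeightOneSpectrum.valuation_of_unit_eq, inv_one]

theorem FinitePlace.ordHom_irreducible {F : Type*} [Field F] (w : FinitePlace F) (x : Fˣ)
    {p : w.ring} (hp : Irreducible p) (h : (x : F) = p) :
    w.ordHom x = Multiplicative.ofAdd 1 := by
  rw [FinitePlace.ordHom, MonoidHom.inv_apply, inv_eq_iff_eq_inv, ← WithZero.coe_inj,
    IsDedekindDomain.HeightOneSpectrum.valuationOfNeZero_eq, h]
  have := (IsDiscreteValuationRing.maximalIdeal w.ring).valuation_of_algebraMap (K := F) p
  refine this.trans ?_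
  rw [IsDedekindDomain.HeightOneSpectrum.intValuation_singleton _ hp.ne_zero]
  · rfl
  · exact (IsDiscreteValuationRing.irreducible_iff_uniformizer p).1 hp

theorem ordHom_smul_of_mem (σ : K ≃ₐ[k] K) (w : FinitePlace K) (x : Kˣ) (hx : (x : K) ∈ w.ring) :
    (σ • w).ordHom (σ • x) = w.ordHom x := by
  obtain ⟨p, hp⟩ := IsDiscreteValuationRing.exists_irreducible w.ring
  have hx0 : (⟨x, hx⟩ : w.ring) ≠ 0 := fun h => x.ne_zero (congrArg Subtype.val h)
  obtain ⟨n, u, hu⟩ := IsDiscreteValuationRing.eq_unit_mul_pow_irreducible hx0 hp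
  have hp0 : (p : K) ≠ 0 := fun h => hp.ne_zero (Subtype.ext h)
  have hxe : x = Units.map (algebraMap w.ring K : w.ring →* K) u * Units.mk0 (p : K) hp0 ^ n :=
    Units.ext (by simpa using congrArg Subtype.val hu)
  have hp' : Irreducible (ringEquivSMul σ w.ring p) :=
    (MulEquiv.irreducible_iff (ringEquivSMul σ w.ring)).2 hp
  rw [hxe, smul_mul', smul_pow', map_mul, map_mul, map_pow, map_pow,
    w.ordHom_unit _ u rfl, w.ordHom_irreducible _ hp rfl,
    (σ • w).ordHom_unit _ (Units.map (ringEquivSMul σ w.ring : _ →* _) u) rfl,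
    (σ • w).ordHom_irreducible _ hp' rfl]

theorem ord_smul (σ : K ≃ₐ[k] K) (w : FinitePlace K) (x : Kˣ) :
    (σ • w).ord (σ • x) = w.ord x := by
  rw [FinitePlace.ord, FinitePlace.ord]
  congr 1
  rcases w.ring.mem_or_inv_mem (x : K) with h | h
  · exact ordHom_smul_of_mem σ w x h
  · have := ordHom_smul_of_mem σ w x⁻¹ (by simpa using h)
    rwa [smul_inv', map_inv, map_inv, inv_inj] at this

theorem liesOver_smul (σ : K ≃ₐ[k] K) (w : FinitePlace K) (v : Place k) :
    LiesOver (Sum.inl (σ • w)) v ↔ LiesOver (Sum.inl w) v := by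
  have h : (σ • w).ring.comap (algebraMap k K) = w.ring.comap (algebraMap k K) := by
    ext x
    rw [ValuationSubring.mem_comap, ValuationSubring.mem_comap,
      ← mem_ring_smul (σ := σ) (w := w), AlgEquiv.commutes]
  rcases v with v | v
  · simp only [LiesOver, h]
  · rfl

theorem smul_mem_placesOver {S : Set (Place k)} (σ : K ≃ₐ[k] K) (w : FinitePlace K) :
    Sum.inl (σ • w) ∈ placesOver K S ↔ Sum.inl w ∈ placesOver K S := by
  simp only [placesOver, Set.mem_ofPred_eq, liesOver_smul]

theorem map_mem_sIntegers {S : Set (Place k)} (σ : K ≃ₐ[k] K) {x : K}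
    (hx : x ∈ sIntegers (placesOver K S)) : σ x ∈ sIntegers (placesOver K S) := by
  intro w hw
  have h := hx (σ⁻¹ • w) (by rwa [smul_mem_placesOver])
  rw [← mem_ring_smul (σ := σ), smul_inv_smul] at h
  exact h

namespace SModulus

variable {S : Set (Place k)} (m : SModulus S)

theorem map_mem_fin (σ : K ≃ₐ[k] K) (a : sIntegers (placesOver K S))
    (ha : a ∈ (m.induced K).fin) :
    (⟨σ a, map_mem_sIntegers σ a.2⟩ : sIntegers (placesOver K S)) ∈ (m.induced K).fin := by
  change a ∈ Ideal.span _ at ha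
  induction ha using Submodule.span_induction with
  | mem a ha =>
    obtain ⟨b, hb, rfl⟩ := ha
    have : (⟨σ (sIntegersMap K S b), map_mem_sIntegers σ (sIntegersMap K S b).2⟩ :
        sIntegers (placesOver K S)) = sIntegersMap K S b :=
      Subtype.ext (σ.commutes b.1)
    rw [this]
    exact Ideal.mem_map_of_mem _ hb
  | zero =>
    convert (m.induced K).fin.zero_mem
    simp
  | add a b _ _ ha hb =>
    convert add_mem ha hb
    simp
  | smul c a _ ha =>
    convert (m.induced K).fin.mul_mem_left ⟨σ c, map_mem_sIntegers σ c.2⟩ ha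
    simp

theorem finDvd_smul_of {σ : K ≃ₐ[k] K} {w : FinitePlace K} (h : (m.induced K).FinDvd w) :
    (m.induced K).FinDvd (σ • w) := by
  refine ⟨by rw [smul_mem_placesOver]; exact h.1, fun a ha => ?_⟩
  have := h.2 _ (m.map_mem_fin σ⁻¹ a ha)
  rw [← mem_nonunits_smul (σ := σ)] at this
  convert this
  exact (σ.apply_symm_apply _).symm

theorem finDvd_smul {σ : K ≃ₐ[k] K} {w : FinitePlace K} :
    (m.induced K).FinDvd (σ • w) ↔ (m.induced K).FinDvd w := by
  refine ⟨fun h => ?_, m.finDvd_smul_of⟩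
  have := m.finDvd_smul_of (σ := σ⁻¹) h
  rwa [inv_smul_smul] at this

theorem map_mem_localIdeal (σ : K ≃ₐ[k] K) (w : FinitePlace K) {x : K}
    (hx : x ∈ (m.induced K).localIdeal w) : σ x ∈ (m.induced K).localIdeal (σ • w) := by
  induction hx using Submodule.span_induction with
  | mem x hx =>
    obtain ⟨a, ha, rfl⟩ := hx
    exact Submodule.subset_span ⟨_, m.map_mem_fin σ a ha, rfl⟩
  | zero => rw [map_zero]; exact zero_mem _
  | add x y _ _ hx hy => rw [map_add]; exact add_mem hx hy
  | smul a x _ hx =>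
    rw [show a • x = (a : K) * x from rfl, map_mul]
    exact Submodule.smul_mem _ (⟨σ a, mem_ring_smul.2 a.2⟩ : (σ • w).ring) hx

theorem smul_mem_rayGroup (σ : K ≃ₐ[k] K) {x : Kˣ} (hx : x ∈ (m.induced K).rayGroup) :
    σ • x ∈ (m.induced K).rayGroup := by
  refine ⟨fun w hw => ?_, fun w hw => ?_⟩
  · have h := m.map_mem_localIdeal σ _ (hx.1 (σ⁻¹ • w) (m.finDvd_smul.2 hw))
    rwa [smul_inv_smul, map_sub, map_one] at h
  · have hr : (w.comap (σ : K →+* K)).IsReal := hw.1.comap _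
    have hmem : w.comap (σ : K →+* K) ∈ (m.induced K).inf := by
      refine ⟨hr, ?_⟩
      rw [← NumberField.InfinitePlace.comap_comp]
      convert hw.2
      ext x
      exact σ.commutes x
    have h := hx.2 _ hmem
    convert h using 1
    apply Complex.ofReal_injective
    rw [NumberField.InfinitePlace.embedding_of_isReal_apply,
      NumberField.InfinitePlace.embedding_of_isReal_apply,
      NumberField.InfinitePlace.comap_embedding_of_isReal _ hr]
    rfl

theorem smul_mem_unitGroup (σ : K ≃ₐ[k] K) {x : Kˣ} (hx : x ∈ (m.induced K).unitGroup) :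
    σ • x ∈ (m.induced K).unitGroup := by
  refine ⟨⟨map_mem_sIntegers σ hx.1.1, ?_⟩, m.smul_mem_rayGroup σ hx.2⟩
  rw [← smul_inv']
  exact map_mem_sIntegers σ hx.1.2

/-- `K^𝔪` as a `Gal(K/k)`-module. -/
instance rayGroupAction : MulDistribMulAction (K ≃ₐ[k] K) (m.induced K).rayGroup where
  smul σ x := ⟨σ • x.1, m.smul_mem_rayGroup σ x.2⟩
  one_smul x := Subtype.ext (one_smul _ x.1)
  mul_smul σ τ x := Subtype.ext (mul_smul σ τ x.1)
  smul_mul σ x y := Subtype.ext (smul_mul' σ x.1 y.1)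
  smul_one σ := Subtype.ext (smul_one σ)

/-- `E^𝔪_{K,S}` as a `Gal(K/k)`-module. -/
instance unitGroupAction : MulDistribMulAction (K ≃ₐ[k] K) (m.induced K).unitGroup where
  smul σ x := ⟨σ • x.1, m.smul_mem_unitGroup σ x.2⟩
  one_smul x := Subtype.ext (one_smul _ x.1)
  mul_smul σ τ x := Subtype.ext (mul_smul σ τ x.1)
  smul_mul σ x y := Subtype.ext (smul_mul' σ x.1 y.1)
  smul_one σ := Subtype.ext (smul_one σ)

theorem smul_mem_divisorGroup (σ : K ≃ₐ[k] K) {D : FinitePlace K →₀ ℤ}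
    (hD : D ∈ (m.induced K).divisorGroup) :
    D.mapDomain (σ • ·) ∈ (m.induced K).divisorGroup := by
  intro w hw
  have h : D.mapDomain (σ • ·) (σ • (σ⁻¹ • w)) = D (σ⁻¹ • w) :=
    Finsupp.mapDomain_apply (MulAction.injective σ) D (σ⁻¹ • w)
  rw [smul_inv_smul] at h
  rw [h]
  refine hD _ ?_
  rcases hw with hw | hw
  · exact Or.inl ((smul_mem_placesOver _ _).2 hw)
  · exact Or.inr (m.finDvd_smul.2 hw)

/-- `I_K^{S(𝔪) ∪ S}` as a `Gal(K/k)`-module: `σ` maps `∑ n_w w` to `∑ n_w σ(w)`. -/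
instance divisorGroupAction : DistribMulAction (K ≃ₐ[k] K) (m.induced K).divisorGroup where
  smul σ D := ⟨D.1.mapDomain (σ • ·), m.smul_mem_divisorGroup σ D.2⟩
  one_smul D := Subtype.ext (by
    change D.1.mapDomain (fun w => (1 : K ≃ₐ[k] K) • w) = D.1
    simp only [one_smul]
    exact Finsupp.mapDomain_id)
  mul_smul σ τ D := Subtype.ext (by
    change D.1.mapDomain (fun w => (σ * τ) • w) = (D.1.mapDomain (τ • ·)).mapDomain (σ • ·)
    rw [← Finsupp.mapDomain_comp]
    simp only [mul_smul]
    rfl)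
  smul_zero σ := Subtype.ext (Finsupp.mapDomain_zero (f := (σ • · : FinitePlace K → FinitePlace K)))
  smul_add σ D E := Subtype.ext Finsupp.mapDomain_add

theorem smul_mem_principalDivisors (σ : K ≃ₐ[k] K) {D : (m.induced K).divisorGroup}
    (hD : D ∈ (m.induced K).principalDivisors) :
    σ • D ∈ (m.induced K).principalDivisors := by
  obtain ⟨x, hx, h⟩ := hD
  refine ⟨σ • x, m.smul_mem_rayGroup σ hx, fun w hw => ?_⟩
  have h1 : (σ • D).1 (σ • (σ⁻¹ • w)) = D.1 (σ⁻¹ • w) :=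
    Finsupp.mapDomain_apply (MulAction.injective σ) D.1 (σ⁻¹ • w)
  have h2 := ord_smul σ (σ⁻¹ • w) x
  rw [smul_inv_smul] at h1 h2
  rw [h1, h2]
  exact h _ (by rwa [smul_mem_placesOver])

/-- `Cl^𝔪_{K,S}` as a `Gal(K/k)`-module. -/
instance classGroupAction : DistribMulAction (K ≃ₐ[k] K) (m.induced K).ClassGroup where
  smul σ := QuotientAddGroup.map (m.induced K).principalDivisors (m.induced K).principalDivisors
    (DistribSMul.toAddMonoidHom _ σ)
    fun _ hD => m.smul_mem_principalDivisors σ hD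
  one_smul c := by
    induction c using QuotientAddGroup.induction_on with
    | H D => exact congrArg QuotientAddGroup.mk (one_smul (K ≃ₐ[k] K) D)
  mul_smul σ τ c := by
    induction c using QuotientAddGroup.induction_on with
    | H D => exact congrArg QuotientAddGroup.mk (mul_smul σ τ D)
  smul_zero σ := map_zero (QuotientAddGroup.map _ _ _ _)
  smul_add σ := map_add (QuotientAddGroup.map _ _ _ _)

end SModulus

end Extension

/-! ### Cohomology -/

section Cohomology

variable {k : Type*} {K : Type} [Field k] [Field K] [Algebra k K]
  {S : Set (Place k)} (m : SModulus S)

variable (K) in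
/-- The `Gal(K/k)`-module `E^𝔪_{K,S}`. -/
abbrev SModulus.unitRep : Rep ℤ (K ≃ₐ[k] K) :=
  Rep.ofMulDistribMulAction (K ≃ₐ[k] K) (m.induced K).unitGroup

variable (K) in
/-- The `Gal(K/k)`-module `K^𝔪`. -/
abbrev SModulus.rayRep : Rep ℤ (K ≃ₐ[k] K) :=
  Rep.ofMulDistribMulAction (K ≃ₐ[k] K) (m.induced K).rayGroup

variable (K) in
/-- The inclusion `E^𝔪_{K,S} → K^𝔪` of `Gal(K/k)`-modules. -/
def SModulus.unitInclusion : m.unitRep K ⟶ m.rayRep K :=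
  Rep.ofHom
    { toLinearMap := (MonoidHom.toAdditive (Subgroup.inclusion inf_le_right :
          (m.induced K).unitGroup →* (m.induced K).rayGroup)).toIntLinearMap
      isIntertwining' := fun _ => rfl }

variable (K) in
/-- The map `H²(Gal(K/k), E^𝔪_{K,S}) → H²(Gal(K/k), K^𝔪)` induced by the inclusion. -/
def SModulus.H2Map :
    groupCohomology.H2 (m.unitRep K) ⟶ groupCohomology.H2 (m.rayRep K) :=
  groupCohomology.map (MonoidHom.id (K ≃ₐ[k] K)) (m.unitInclusion K) 2

end Cohomology

end RayClass

section FunctionField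

open Polynomial

theorem Polynomial.iterateFrobenius_finite_zmod (p : ℕ) [Fact p.Prime] (n : ℕ) :
    (iterateFrobenius (ZMod p)[X] p n).Finite := by
  refine RingHom.IsIntegral.to_finite ?_ ?_
  · intro a
    refine ⟨X ^ p ^ n - C a, monic_X_pow_sub_C _ (pow_ne_zero _ (Fact.out : p.Prime).ne_zero), ?_⟩
    simp [iterateFrobenius_def]
  · have h : (iterateFrobenius (ZMod p)[X] p n).comp (C : ZMod p →+* (ZMod p)[X]) = C :=
      Subsingleton.elim _ _
    refine RingHom.FiniteType.of_comp_finiteType (f := (C : ZMod p →+* (ZMod p)[X])) ?_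
    rw [h]
    exact RingHom.finiteType_algebraMap.2
      (inferInstance : Algebra.FiniteType (ZMod p) (ZMod p)[X])

instance Polynomial.hasFiniteQuotients (k : Type*) [Field k] [Finite k] :
    Ring.HasFiniteQuotients k[X] where
  finiteQuotient {I} hI := by
    obtain ⟨f, rfl⟩ := Submodule.IsPrincipal.principal I
    have hf : f ≠ 0 := by simpa using hI
    have : Module.Finite k (AdjoinRoot f) :=
      (AdjoinRoot.powerBasis hf).finite
    exact Module.finite_of_finite k (M := AdjoinRoot f)

variable (p : ℕ) [Fact p.Prime] (Q F : Type*) [Field Q] [Field F] [Algebra (ZMod p)[X] Q]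
  [IsFractionRing (ZMod p)[X] Q] [Algebra (ZMod p)[X] F] [Algebra Q F]
  [IsScalarTower (ZMod p)[X] Q F] [FiniteDimensional Q F]

include Q in
/-- The integral closure of `𝔽_p[X]` in a finite extension of `𝔽_p(X)`, separable or not, is
finite: a power of Frobenius embeds it into its separable part. -/
theorem integralClosure_polynomial_zmod_finite :
    Module.Finite (ZMod p)[X] (integralClosure (ZMod p)[X] F) := by
  have : CharP Q p := charP_of_injective_algebraMap (IsFractionRing.injective (ZMod p)[X] Q) p
  have : CharP F p := charP_of_injective_algebraMap (algebraMap Q F).injective p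
  let Fs := separableClosure Q F
  have : CharP Fs p := charP_of_injective_algebraMap (algebraMap Q Fs).injective p
  have : IsScalarTower (ZMod p)[X] Fs F :=
    .of_algebraMap_eq fun _ => rfl
  let Rs := integralClosure (ZMod p)[X] Fs
  have hfin : Module.Finite (ZMod p)[X] Rs := IsIntegralClosure.finite (ZMod p)[X] Q Fs Rs
  obtain ⟨n, hn⟩ : ∃ n, ∀ x : F, x ^ p ^ n ∈ Fs := by
    obtain ⟨e, he⟩ := (IsPurelyInseparable.hasExponent_iff' Fs F p).1 inferInstance
    refine ⟨e, fun x => ?_⟩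
    obtain ⟨y, hy⟩ := he x
    rw [← hy]
    exact y.2
  let φ₀ : integralClosure (ZMod p)[X] F →+* Fs :=
    ((iterateFrobenius F p n).comp (integralClosure (ZMod p)[X] F).subtype).codRestrict Fs.toSubring
      fun x => hn x
  have hφ₀ : ∀ x, ((φ₀ x : Fs) : F) = (x : F) ^ p ^ n := fun x => iterateFrobenius_def _ _ _
  let φ : integralClosure (ZMod p)[X] F →+* Rs := φ₀.codRestrict Rs.toSubring fun x => by
    change IsIntegral _ _
    rw [← isIntegral_algebraMap_iff (B := F) (algebraMap Fs F).injective]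
    change IsIntegral _ ((φ₀ x : Fs) : F)
    rw [hφ₀]
    exact x.2.pow _
  have hφ : ∀ x, (((φ x : Rs) : Fs) : F) = (x : F) ^ p ^ n := hφ₀
  have hinj : Function.Injective φ := by
    intro x y h
    have h1 : (x : F) ^ p ^ n = (y : F) ^ p ^ n := by rw [← hφ, ← hφ, h]
    exact Subtype.ext (iterateFrobenius_inj F p n h1)
  let f : (ZMod p)[X] →+* Rs := (algebraMap (ZMod p)[X] Rs).comp (iterateFrobenius (ZMod p)[X] p n)
  have hf : f.Finite := RingHom.Finite.comp
    (RingHom.finite_algebraMap.2 hfin) (Polynomial.iterateFrobenius_finite_zmod p n)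
  have hcomp : ∀ a, f a = φ (algebraMap _ _ a) := by
    intro a
    apply Subtype.ext
    apply Subtype.ext
    rw [hφ]
    change algebraMap (ZMod p)[X] F (iterateFrobenius (ZMod p)[X] p n a) = _
    rw [iterateFrobenius_def, map_pow]
    rfl
  let : Module (ZMod p)[X] Rs := f.toModule
  have : Module.Finite (ZMod p)[X] Rs := hf
  let ψ : integralClosure (ZMod p)[X] F →ₗ[(ZMod p)[X]] Rs :=
    { φ with
      map_smul' := fun a x => by
        change φ (a • x) = f a * φ x
        rw [hcomp, ← map_mul, Algebra.smul_def] }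
  exact Module.Finite.of_injective ψ hinj

include Q in
theorem integralClosure_polynomial_zmod_isFractionRing :
    IsFractionRing (integralClosure (ZMod p)[X] F) F :=
  IsIntegralClosure.isFractionRing_of_finite_extension (ZMod p)[X] Q F _

include Q in
theorem integralClosure_polynomial_zmod_hasFiniteQuotients :
    Ring.HasFiniteQuotients (integralClosure (ZMod p)[X] F) :=
  have := integralClosure_polynomial_zmod_finite p Q F
  Ring.HasFiniteQuotients.of_module_finite (ZMod p)[X] _

include Q in
theorem integralClosure_polynomial_zmod_isDedekindDomain :
    IsDedekindDomain (integralClosure (ZMod p)[X] F) :=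
  have := integralClosure_polynomial_zmod_isFractionRing p Q F
  have := integralClosure_polynomial_zmod_hasFiniteQuotients p Q F
  have hn : IsNoetherianRing (integralClosure (ZMod p)[X] F) := inferInstance
  have hd : Ring.DimensionLEOne (integralClosure (ZMod p)[X] F) := inferInstance
  { hn, hd, (isIntegrallyClosed_iff F).mpr fun {x} hx =>
      ⟨IsIntegralClosure.mk' _ x (isIntegral_trans (R := (ZMod p)[X]) _ hx),
        IsIntegralClosure.algebraMap_mk' _ _ _⟩ with }

include Q in
theorem integralClosure_polynomial_zmod_finite_classGroup :
    Finite (ClassGroup (integralClosure (ZMod p)[X] F)) := by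
  classical
  have := integralClosure_polynomial_zmod_isDedekindDomain p Q F
  have := integralClosure_polynomial_zmod_finite p Q F
  have : FaithfulSMul (ZMod p)[X] F := by
    rw [faithfulSMul_iff_algebraMap_injective, IsScalarTower.algebraMap_eq (ZMod p)[X] Q F]
    exact (algebraMap Q F).injective.comp (IsFractionRing.injective _ _)
  have : Module.IsTorsionFree (ZMod p)[X] F := inferInstance
  have : Module.Free (ZMod p)[X] (integralClosure (ZMod p)[X] F) := inferInstance
  have h := ClassGroup.fintypeOfAdmissibleOfAlgebraic
    (Module.Free.chooseBasis (ZMod p)[X] (integralClosure (ZMod p)[X] F))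
    (Polynomial.cardPowDegreeIsAdmissible :
      AbsoluteValue.IsAdmissible (Polynomial.cardPowDegree : AbsoluteValue (ZMod p)[X] ℤ))
  infer_instance

end FunctionField

namespace RayClass

open IsDedekindDomain WithZero

theorem mem_valuationSubring_of_isIntegral {A F : Type*} [CommRing A] [Field F] [Algebra A F]
    (V : ValuationSubring F) (hA : ∀ a, algebraMap A F a ∈ V) {x : F} (hx : IsIntegral A x) :
    x ∈ V := by
  let φ : A →+* V := (algebraMap A F).codRestrict V.toSubring hA
  have hx' : IsIntegral V x := by
    obtain ⟨f, hf, hfx⟩ := hx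
    refine ⟨f.map φ, hf.map φ, ?_⟩
    rw [Polynomial.eval₂_map]
    exact hfx
  obtain ⟨y, hy⟩ := IsIntegrallyClosed.isIntegral_iff.1 hx'
  rw [← hy]
  exact y.2

section FinitePlace

variable {F : Type*} [Field F]

namespace FinitePlace

variable (w : FinitePlace F)

theorem ord_mul (x y : Fˣ) : w.ord (x * y) = w.ord x + w.ord y := by simp [ord]

theorem ord_one : w.ord 1 = 0 := by simp [ord]

theorem ord_inv (x : Fˣ) : w.ord x⁻¹ = -w.ord x := by simp [ord]

theorem ord_pow (x : Fˣ) (n : ℕ) : w.ord (x ^ n) = n * w.ord x := by simp [ord]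

theorem ord_zpow (x : Fˣ) (n : ℤ) : w.ord (x ^ n) = n * w.ord x := by simp [ord]

theorem valuation_eq_exp_neg_ord (x : Fˣ) :
    (IsDiscreteValuationRing.maximalIdeal w.ring).valuation F x = exp (-w.ord x) := by
  rw [← HeightOneSpectrum.valuationOfNeZero_eq, ord, ordHom, MonoidHom.inv_apply, toAdd_inv,
    neg_neg]
  rfl

theorem mem_ring_iff (x : Fˣ) : (x : F) ∈ w.ring ↔ 0 ≤ w.ord x := by
  rw [← valuation_le_one_iff, valuation_eq_exp_neg_ord, ← exp_zero, exp_le_exp, neg_nonpos]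

theorem mem_nonunits_iff (x : Fˣ) : (x : F) ∈ w.ring.nonunits ↔ 0 < w.ord x := by
  rw [ValuationSubring.mem_nonunits_iff_or, or_iff_right x.ne_zero, ← Units.val_inv_eq_inv_val,
    mem_ring_iff, ord_inv]
  omega

theorem exists_ord_eq_one : ∃ x : Fˣ, w.ord x = 1 := by
  obtain ⟨π, hπ⟩ := IsDiscreteValuationRing.exists_irreducible w.ring
  refine ⟨Units.mk0 π (fun h => hπ.ne_zero (Subtype.ext h)), ?_⟩
  rw [ord, w.ordHom_irreducible _ hπ rfl]
  rfl

theorem ring_ne_top : w.ring ≠ ⊤ := by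
  intro h
  obtain ⟨x, hx⟩ := w.exists_ord_eq_one
  have h1 : ((x⁻¹ : Fˣ) : F) ∈ w.ring := h ▸ ValuationSubring.mem_top _
  rw [mem_ring_iff, ord_inv] at h1
  omega

/-- A normalized discrete valuation with valuation ring `O_w` is `exp (-ord_w)`. -/
theorem valuation_eq_of_le_one_iff (u : Valuation F ℤᵐ⁰) (h : ∀ x, u x ≤ 1 ↔ x ∈ w.ring)
    (hs : ∃ y, u y = exp (-1)) (x : Fˣ) : u x = exp (-w.ord x) := by
  have hunit : ∀ y : Fˣ, w.ord y = 0 → u y = 1 := by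
    intro y hy
    apply le_antisymm
    · rw [h, mem_ring_iff, hy]
    · have h1 : u ((y⁻¹ : Fˣ) : F) ≤ 1 := by rw [h, mem_ring_iff, ord_inv, hy, neg_zero]
      rw [Units.val_inv_eq_inv_val, map_inv₀] at h1
      exact (inv_le_one₀ (zero_lt_iff.2 ((Valuation.ne_zero_iff _).2 y.ne_zero))).1 h1
  obtain ⟨π, hπ⟩ := w.exists_ord_eq_one
  have hval : ∀ y : Fˣ, u y = u π ^ w.ord y := by
    intro y
    have := hunit (y * π ^ (-w.ord y)) (by rw [ord_mul, ord_zpow, hπ]; ring)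
    rw [Units.val_mul, map_mul, Units.val_zpow_eq_zpow_val, map_zpow₀, zpow_neg] at this
    exact (mul_inv_eq_one₀ (zpow_ne_zero _ ((Valuation.ne_zero_iff _).2 π.ne_zero))).1 this
  have hπ0 : u π ≠ 0 := (Valuation.ne_zero_iff _).2 π.ne_zero
  have hπu : u π = exp (log (u π)) := (exp_log hπ0).symm
  set k := log (u π) with hk
  have hkle : k ≤ 0 := by
    have := (h π).2 (by rw [mem_ring_iff, hπ]; exact zero_le_one)
    rwa [hπu, ← exp_zero, exp_le_exp] at this
  obtain ⟨y, hy⟩ := hs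
  have hy0 : y ≠ 0 := by
    rintro rfl
    rw [map_zero] at hy
    exact exp_ne_zero hy.symm
  have h1 := hval (Units.mk0 y hy0)
  rw [Units.val_mk0, hy, hπu, ← exp_zsmul, exp_inj, smul_eq_mul] at h1
  have h2 : k = -1 := by
    rcases Int.isUnit_iff.1 (IsUnit.of_mul_eq_one (-w.ord (Units.mk0 y hy0)) (a := k)
      (by linarith)) with h3 | h3 <;> omega
  rw [hval, hπu, ← exp_zsmul, h2]
  simp

end FinitePlace

section Dedekind

variable (F) {R : Type*} [CommRing R] [IsDedekindDomain R] [Algebra R F] [IsFractionRing R F]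

/-- The finite place of `F` defined by a maximal ideal of a Dedekind domain with field of
fractions `F`. -/
def placeOfPrime (v : HeightOneSpectrum R) : FinitePlace F where
  ring := (v.valuation F).valuationSubring
  isDVR := by
    have : Nontrivial (MonoidWithZeroHom.valueGroup (.ofClass (v.valuation F))) := by
      obtain ⟨π, hπ⟩ := v.valuation_exists_uniformizer F
      have h0 : v.valuation F π ≠ 0 := by rw [hπ]; exact exp_ne_zero
      rw [Subgroup.nontrivial_iff_exists_ne_one]
      refine ⟨Units.mk0 (v.valuation F π) h0, MonoidWithZeroHom.mem_valueGroup _ ⟨π, rfl⟩,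
        fun h => ?_⟩
      have := congrArg Units.val h
      rw [Units.val_mk0, hπ, Units.val_one, ← exp_zero, exp_inj] at this
      omega
    infer_instance

variable {F}

theorem mem_placeOfPrime_ring (v : HeightOneSpectrum R) (x : F) :
    x ∈ (placeOfPrime F v).ring ↔ v.valuation F x ≤ 1 := Iff.rfl

theorem valuation_eq_exp_neg_ord_placeOfPrime (v : HeightOneSpectrum R) (x : Fˣ) :
    v.valuation F x = exp (-(placeOfPrime F v).ord x) :=
  (placeOfPrime F v).valuation_eq_of_le_one_iff _ (fun _ => Iff.rfl)
    (v.valuation_exists_uniformizer F) x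

theorem algebraMap_mem_placeOfPrime_ring (v : HeightOneSpectrum R) (r : R) :
    algebraMap R F r ∈ (placeOfPrime F v).ring := v.valuation_le_one r

theorem exists_valuationSubring_eq_placeOfPrime_ring (V : ValuationSubring F) (hV : V ≠ ⊤)
    (hR : ∀ r : R, algebraMap R F r ∈ V) :
    ∃ v : HeightOneSpectrum R, (placeOfPrime F v).ring = V := by
  let f : R →+* V := (algebraMap R F).codRestrict V.toSubring hR
  have hf : ∀ r, r ∈ (IsLocalRing.maximalIdeal V).comap f ↔ algebraMap R F r ∈ V.nonunits := by
    intro r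
    rw [Ideal.mem_comap, ← ValuationSubring.coe_mem_nonunits_iff]
    rfl
  have hinv : ∀ r, algebraMap R F r ∉ V.nonunits → (algebraMap R F r)⁻¹ ∈ V := by
    intro r hr
    rw [ValuationSubring.mem_nonunits_iff_or] at hr
    push Not at hr
    exact hr.2
  let v : HeightOneSpectrum R :=
    { asIdeal := (IsLocalRing.maximalIdeal V).comap f
      isPrime := inferInstance
      ne_bot := by
        intro h
        refine hV (top_le_iff.1 fun x _ => ?_)
        obtain ⟨a, b, hb, rfl⟩ := IsFractionRing.div_surjective (A := R) x
        rw [div_eq_mul_inv]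
        refine mul_mem (hR a) (hinv b fun hb' => nonZeroDivisors.ne_zero hb ?_)
        rw [← hf, h] at hb'
        exact hb' }
  refine ⟨v, ?_⟩
  have hle : (placeOfPrime F v).ring ≤ V := by
    intro x hx
    obtain ⟨n, d, h⟩ := v.exists_primeCompl_mul_eq_of_integer x hx
    have hd : algebraMap R F d ∉ V.nonunits := fun h' => d.2 ((hf _).2 h')
    have hd0 : algebraMap R F d ≠ 0 := by
      intro h0
      exact hd (by rw [ValuationSubring.mem_nonunits_iff_or]; exact Or.inl h0)
    rw [eq_div_of_mul_eq hd0 h, div_eq_mul_inv]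
    exact mul_mem (hR n) (hinv _ hd)
  exact ValuationSubring.eq_of_le_of_ne_top _ hle hV

theorem exists_placeOfPrime_eq (w : FinitePlace F) (hR : ∀ r : R, algebraMap R F r ∈ w.ring) :
    ∃ v : HeightOneSpectrum R, placeOfPrime F v = w := by
  obtain ⟨v, hv⟩ := exists_valuationSubring_eq_placeOfPrime_ring w.ring w.ring_ne_top hR
  exact ⟨v, FinitePlace.ext hv⟩

theorem placeOfPrime_injective :
    Function.Injective (placeOfPrime F : HeightOneSpectrum R → FinitePlace F) := by
  intro v v' h
  refine HeightOneSpectrum.eq_of_valuation_isEquiv_valuation (K := F) ?_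
  rw [Valuation.isEquiv_iff_val_le_one]
  intro x
  rw [← mem_placeOfPrime_ring, ← mem_placeOfPrime_ring, h]

variable (R) in
theorem finite_setOf_ord_ne_zero_of_dedekind (x : Fˣ) :
    {w : FinitePlace F | (∀ r : R, algebraMap R F r ∈ w.ring) ∧ w.ord x ≠ 0}.Finite := by
  refine (((HeightOneSpectrum.Support.finite R (x : F)).union
    (HeightOneSpectrum.Support.finite R ((x⁻¹ : Fˣ) : F))).image (placeOfPrime F)).subset ?_
  rintro w ⟨hR, hw⟩
  obtain ⟨v, rfl⟩ := exists_placeOfPrime_eq w hR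
  refine ⟨v, ?_, rfl⟩
  change 1 < v.valuation F (x : F) ∨ 1 < v.valuation F ((x⁻¹ : Fˣ) : F)
  rw [valuation_eq_exp_neg_ord_placeOfPrime, valuation_eq_exp_neg_ord_placeOfPrime, ← exp_zero,
    exp_lt_exp, exp_lt_exp, FinitePlace.ord_inv]
  omega

variable (R) in
theorem exists_algebraMap_eq_of_forall_mem {x : F}
    (hx : ∀ w : FinitePlace F, (∀ r : R, algebraMap R F r ∈ w.ring) → x ∈ w.ring) :
    ∃ r : R, algebraMap R F r = x :=
  HeightOneSpectrum.mem_integers_of_valuation_le_one F x fun v =>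
    hx _ (algebraMap_mem_placeOfPrime_ring v)

end Dedekind
end FinitePlace
end RayClass

namespace RayClass

open IsDedekindDomain WithZero Polynomial

section

variable {F : Type*} [Field F]

/-- `R` is a Dedekind domain with field of fractions `F`, finite class group and finite quotients. -/
structure IsArithmeticSubring (R : Subring F) : Prop where
  isDedekindDomain : IsDedekindDomain R
  isFractionRing : IsFractionRing R F
  hasFiniteQuotients : Ring.HasFiniteQuotients R
  finite_classGroup : Finite (ClassGroup R)

variable {p : ℕ} [Fact p.Prime] [Algebra (ZMod p) F] 

theorem exists_arithmeticSubring_of_transcendental [Algebra.EssFiniteType (ZMod p) F]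
    (htr : Algebra.trdeg (ZMod p) F = 1) {x : F} (hx : Transcendental (ZMod p) x) :
    ∃ R : Subring F, IsArithmeticSubring R ∧ x ∈ R ∧
      (∀ V : ValuationSubring F, x ∈ V → R ≤ V.toSubring) ∧
      (∀ z : F, ∃ f : (ZMod p)[X], f ≠ 0 ∧ aeval x f * z ∈ R) ∧
      ∃ s : Finset F, (∀ b ∈ s, b ∈ R) ∧
        ∀ z ∈ R, ∃ f : F → (ZMod p)[X], z = ∑ b ∈ s, aeval x (f b) * b := by
  classical
  let : Algebra (ZMod p)[X] F := (aeval x).toAlgebra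
  have hmap : ∀ f : (ZMod p)[X], algebraMap (ZMod p)[X] F f = aeval x f := fun f => rfl
  have : IsScalarTower (ZMod p) (ZMod p)[X] F := .of_algebraMap_eq fun a => by
    rw [hmap, algebraMap_eq, aeval_C]
  have hinj : Function.Injective (algebraMap (ZMod p)[X] F) :=
    transcendental_iff_injective.1 hx
  have : FaithfulSMul (ZMod p)[X] F := (faithfulSMul_iff_algebraMap_injective _ _).2 hinj
  have halg : Algebra.IsAlgebraic (ZMod p)[X] F := by
    rw [← trdeg_eq_zero_iff]
    have h := lift_trdeg_add_eq (ZMod p) (ZMod p)[X] F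
    rw [htr, Polynomial.trdeg_of_isDomain, Cardinal.lift_one, Cardinal.lift_one] at h
    have h2 : Algebra.trdeg (ZMod p)[X] F < Cardinal.aleph0 := by
      rw [← Cardinal.lift_lt_aleph0]
      exact (self_le_add_left _ _).trans_lt (h ▸ Cardinal.one_lt_aleph0)
    obtain ⟨n, hn⟩ := Cardinal.lt_aleph0.1 h2
    rw [hn] at h ⊢
    simp only [Cardinal.lift_natCast] at h
    norm_cast at h ⊢
    omega
  let := FractionRing.liftAlgebra (ZMod p)[X] F
  let Q := FractionRing (ZMod p)[X]
  have : Algebra.IsAlgebraic Q F := Algebra.IsAlgebraic.extendScalars (R := (ZMod p)[X])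
    (IsFractionRing.injective (ZMod p)[X] Q)
  have : Algebra.EssFiniteType Q F := Algebra.EssFiniteType.of_comp (ZMod p) Q F
  have : FiniteDimensional Q F := Algebra.finite_of_essFiniteType_of_isAlgebraic
  let R := integralClosure (ZMod p)[X] F
  refine ⟨R.toSubring, ⟨integralClosure_polynomial_zmod_isDedekindDomain p Q F,
    integralClosure_polynomial_zmod_isFractionRing p Q F,
    integralClosure_polynomial_zmod_hasFiniteQuotients p Q F,
    integralClosure_polynomial_zmod_finite_classGroup p Q F⟩, ?_, ?_, ?_, ?_⟩
  · have h := isIntegral_algebraMap (R := (ZMod p)[X]) (A := F) (x := X)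
    rwa [hmap, aeval_X] at h
  · intro V hV z hz
    refine mem_valuationSubring_of_isIntegral (A := (ZMod p)[X]) V (fun f => ?_) hz
    rw [hmap, aeval_eq_sum_range]
    refine sum_mem fun i _ => ?_
    rw [Algebra.smul_def]
    refine mul_mem ?_ (pow_mem hV i)
    rw [← ZMod.natCast_zmod_val (f.coeff i), map_natCast]
    exact natCast_mem V _
  · intro z
    obtain ⟨f, hf, h⟩ := (halg.isAlgebraic z).exists_integral_multiple
    refine ⟨f, hf, ?_⟩
    rwa [Algebra.smul_def] at h
  · obtain ⟨s, hs⟩ := (integralClosure_polynomial_zmod_finite p Q F).fg_top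
    refine ⟨s.image Subtype.val, ?_, ?_⟩
    · intro b hb
      obtain ⟨b, _, rfl⟩ := Finset.mem_image.1 hb
      exact b.2
    · intro z hz
      have h : (⟨z, hz⟩ : R) ∈ Submodule.span (ZMod p)[X] (s : Set R) := hs ▸ Submodule.mem_top
      obtain ⟨f, hf⟩ := Submodule.mem_span_finset.1 h
      have h2 := congrArg Subtype.val hf.2
      refine ⟨fun b => if hb : b ∈ R then f ⟨b, hb⟩ else 0, ?_⟩
      rw [Finset.sum_image (fun a _ b _ h => Subtype.ext h)]
      rw [← show _ = z from h2, AddSubmonoidClass.coe_finsetSum]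
      refine Finset.sum_congr rfl fun b _ => ?_
      simp only [dif_pos b.2, ← hmap]
      exact Algebra.smul_def (f b) (b : F)

end
end RayClass

namespace RayClass

open IsDedekindDomain WithZero Polynomial

section

variable {F : Type*} [Field F]

theorem FinitePlace.div_mem_ring_of_ord_le (w : FinitePlace F) {a b : Fˣ} (h : w.ord a ≤ w.ord b) :
    (b : F) / a ∈ w.ring := by
  rw [div_eq_mul_inv, ← Units.val_inv_eq_inv_val, ← Units.val_mul, w.mem_ring_iff, w.ord_mul,
    w.ord_inv]
  omega

/-- The ring `O_w / a O_w` is finite. -/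
theorem exists_finite_forall_sub_div_mem (R : Type*) [CommRing R] [IsDedekindDomain R]
    [Algebra R F] [IsFractionRing R F] [Ring.HasFiniteQuotients R] (w : FinitePlace F)
    (hR : ∀ r : R, algebraMap R F r ∈ w.ring) (a : Fˣ) :
    ∃ T : Set F, T.Finite ∧ ∀ x ∈ w.ring, ∃ t ∈ T, (x - t) / a ∈ w.ring := by
  obtain ⟨v, rfl⟩ := exists_placeOfPrime_eq w hR
  set w := placeOfPrime F v
  obtain ⟨r, s, hs, hrs⟩ := IsFractionRing.div_surjective (A := R) (a : F)
  have hr : r ≠ 0 := by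
    rintro rfl
    rw [map_zero, zero_div] at hrs
    exact a.ne_zero hrs.symm
  have hs0 : algebraMap R F s ≠ 0 :=
    (map_ne_zero_iff _ (IsFractionRing.injective R F)).2 (nonZeroDivisors.ne_zero hs)
  have hra : algebraMap R F r = a * algebraMap R F s := by
    rw [← hrs, div_mul_cancel₀ _ hs0]
  have hfin : Finite (R ⧸ Ideal.span {r}) :=
    Ring.HasFiniteQuotients.finiteQuotient (by simpa using hr)
  refine ⟨Set.range fun q : R ⧸ Ideal.span {r} => algebraMap R F q.out, Set.finite_range _, ?_⟩
  intro x hx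
  have ha0 : v.valuation F a ≠ 0 := (Valuation.ne_zero_iff _).2 a.ne_zero
  obtain ⟨b, hb⟩ := v.exists_valuation_sub_lt_of_integer hx (Units.mk0 _ ha0)
  refine ⟨_, ⟨Ideal.Quotient.mk _ b, rfl⟩, ?_⟩
  obtain ⟨c, hc⟩ : ∃ c, b - (Ideal.Quotient.mk (Ideal.span {r}) b).out = r * c := by
    rw [← dvd_def, ← Ideal.mem_span_singleton, ← Ideal.Quotient.eq]
    exact (Quotient.out_eq (Ideal.Quotient.mk (Ideal.span {r}) b)).symm
  have h1 : (x - algebraMap R F b) / a ∈ w.ring := by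
    change v.valuation F _ ≤ 1
    rw [map_div₀, Valuation.map_sub_swap]
    exact (div_le_one₀ (zero_lt_iff.2 ha0)).2 hb.le
  have h2 : (x - algebraMap R F (Ideal.Quotient.mk (Ideal.span {r}) b).out) / a
      = (x - algebraMap R F b) / a + algebraMap R F (s * c) := by
    have h3 := congrArg (algebraMap R F) hc
    rw [map_sub, map_mul, hra] at h3
    have ha := a.ne_zero
    rw [map_mul]
    field_simp
    linear_combination h3
  rw [h2]
  exact add_mem h1 (hR _)

theorem exists_transcendental_of_trdeg_eq_one {k : Type*} [Field k] [Algebra k F]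
    (htr : Algebra.trdeg k F = 1) : ∃ x : F, Transcendental k x := by
  by_contra! h
  have : Algebra.IsAlgebraic k F := ⟨fun x => not_not.1 (h x)⟩
  rw [trdeg_eq_zero] at htr
  exact zero_ne_one htr

theorem transcendental_inv {k : Type*} [Field k] [Algebra k F] {x : F}
    (hx : Transcendental k x) : Transcendental k x⁻¹ :=
  fun h => hx (inv_inv x ▸ h.inv)

variable {p : ℕ} [Fact p.Prime] [Algebra (ZMod p) F]

theorem mem_ring_of_isAlgebraic {x : F} (hx : IsAlgebraic (ZMod p) x) (w : FinitePlace F) :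
    x ∈ w.ring := by
  refine mem_valuationSubring_of_isIntegral w.ring (fun a => ?_) hx.isIntegral
  rw [← ZMod.natCast_zmod_val a, map_natCast]
  exact natCast_mem w.ring _

variable [Algebra.EssFiniteType (ZMod p) F] (htr : Algebra.trdeg (ZMod p) F = 1)
include htr

theorem exists_arithmeticSubring_le_of_trdeg_eq_one (V : ValuationSubring F) :
    ∃ R : Subring F, IsArithmeticSubring R ∧ R ≤ V.toSubring := by
  obtain ⟨x, hx⟩ := exists_transcendental_of_trdeg_eq_one htr
  rcases V.mem_or_inv_mem x with h | h
  · obtain ⟨R, hR, -, h1, -⟩ := exists_arithmeticSubring_of_transcendental htr hx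
    exact ⟨R, hR, h1 V h⟩
  · obtain ⟨R, hR, -, h1, -⟩ := exists_arithmeticSubring_of_transcendental htr
      (transcendental_inv hx)
    exact ⟨R, hR, h1 V h⟩

/-- The valuation subrings of a function field are the finite places and the trivial one. -/
theorem exists_finitePlace_of_trdeg_eq_one (V : ValuationSubring F) (hV : V ≠ ⊤) :
    ∃ w : FinitePlace F, w.ring = V := by
  obtain ⟨R, hR, hRV⟩ := exists_arithmeticSubring_le_of_trdeg_eq_one htr V
  have := hR.isDedekindDomain
  have := hR.isFractionRing
  obtain ⟨v, hv⟩ := exists_valuationSubring_eq_placeOfPrime_ring (R := R) V hV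
    fun r => hRV r.2
  exact ⟨_, hv⟩

theorem finite_setOf_ord_ne_zero_of_trdeg_eq_one (x : Fˣ) :
    {w : FinitePlace F | w.ord x ≠ 0}.Finite := by
  obtain ⟨t, ht⟩ := exists_transcendental_of_trdeg_eq_one htr
  obtain ⟨R, hR, -, h1, -⟩ := exists_arithmeticSubring_of_transcendental htr ht
  obtain ⟨R', hR', -, h1', -⟩ := exists_arithmeticSubring_of_transcendental htr
    (transcendental_inv ht)
  have := hR.isDedekindDomain
  have := hR.isFractionRing
  have := hR'.isDedekindDomain
  have := hR'.isFractionRing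
  refine ((finite_setOf_ord_ne_zero_of_dedekind R x).union
    (finite_setOf_ord_ne_zero_of_dedekind R' x)).subset fun w hw => ?_
  rcases w.ring.mem_or_inv_mem t with h | h
  · exact Or.inl ⟨fun r => h1 _ h r.2, hw⟩
  · exact Or.inr ⟨fun r => h1' _ h r.2, hw⟩

theorem isAlgebraic_of_forall_mem_ring {x : F} (hx : ∀ w : FinitePlace F, x ∈ w.ring) :
    IsAlgebraic (ZMod p) x := by
  have h : x ∈ (⨅ V : {V : ValuationSubring F // (∅ : Set F) ⊆ V.toSubring}, V.1.toSubring) := by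
    rw [Subring.mem_iInf]
    rintro ⟨V, -⟩
    by_cases hV : V = ⊤
    · subst hV
      exact ValuationSubring.mem_top x
    · obtain ⟨w, rfl⟩ := exists_finitePlace_of_trdeg_eq_one htr V hV
      exact hx w
  rw [iInf_valuationSubring_superset] at h
  have hle : Subring.closure (∅ : Set F) ≤ (algebraMap (ZMod p) F).range :=
    Subring.closure_le.2 (Set.empty_subset _)
  obtain ⟨f, hf, hfx⟩ := h
  have h1 : f.map (algebraMap (Subring.closure (∅ : Set F)) F) ∈ lifts (algebraMap (ZMod p) F) := by
    rw [lifts_iff_coeff_lifts]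
    intro n
    rw [coeff_map]
    exact hle (f.coeff n).2
  obtain ⟨g, hg, -, hgm⟩ := lifts_and_natDegree_eq_and_monic h1 (hf.map _)
  refine ⟨g, hgm.ne_zero, ?_⟩
  rw [aeval_def, ← eval_map, hg, eval_map]
  exact hfx

/-- The field of constants of a global function field is finite. -/
theorem finite_setOf_isAlgebraic_of_finitePlace (w : FinitePlace F) :
    {x : F | IsAlgebraic (ZMod p) x}.Finite := by
  obtain ⟨R, hR, hRw⟩ := exists_arithmeticSubring_le_of_trdeg_eq_one htr w.ring
  have := hR.isDedekindDomain
  have := hR.isFractionRing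
  have := hR.hasFiniteQuotients
  obtain ⟨π, hπ⟩ := w.exists_ord_eq_one
  obtain ⟨T, hT, h⟩ := exists_finite_forall_sub_div_mem R w (fun r => hRw r.2) π
  choose! t ht h using h
  refine Set.Finite.of_finite_image (f := t) (hT.subset ?_) ?_
  · rintro _ ⟨x, hx, rfl⟩
    exact ht x (mem_ring_of_isAlgebraic hx w)
  · intro x hx y hy hxy
    by_contra hne
    have h1 := sub_mem (h x (mem_ring_of_isAlgebraic hx w)) (h y (mem_ring_of_isAlgebraic hy w))
    rw [hxy, ← sub_div, sub_sub_sub_cancel_right] at h1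
    have h2 : IsAlgebraic (ZMod p) (x - y)⁻¹ := (IsAlgebraic.sub hx hy).inv
    have h3 := mul_mem h1 (mem_ring_of_isAlgebraic h2 w)
    rw [div_mul_eq_mul_div, mul_inv_cancel₀ (sub_ne_zero.2 hne), one_div,
      ← Units.val_inv_eq_inv_val, w.mem_ring_iff, w.ord_inv, hπ] at h3
    omega

end
end RayClass

namespace RayClass

open IsDedekindDomain WithZero Polynomial

section

variable {F : Type*} [Field F]

theorem exists_pole_of_arithmeticSubring {R : Subring F} (hR : IsArithmeticSubring R)
    (w₀ : FinitePlace F) (hw₀ : R ≤ w₀.ring.toSubring) :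
    ∃ y : F, y ∉ w₀.ring ∧
      ∀ w : FinitePlace F, R ≤ w.ring.toSubring → w ≠ w₀ → y ∈ w.ring := by
  have := hR.isDedekindDomain
  have := hR.isFractionRing
  have := hR.finite_classGroup
  obtain ⟨v₀, rfl⟩ := exists_placeOfPrime_eq (R := R) w₀ fun r => hw₀ r.2
  have hI : v₀.asIdeal ∈ nonZeroDivisors (Ideal R) := mem_nonZeroDivisors_of_ne_zero v₀.ne_bot
  have hp : (v₀.asIdeal ^ Nat.card (ClassGroup R)).IsPrincipal := by
    rw [← ClassGroup.mk0_eq_one_iff (pow_mem hI _)]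
    have h := pow_card_eq_one' (x := ClassGroup.mk0 ⟨v₀.asIdeal, hI⟩)
    rw [← map_pow] at h
    exact h
  obtain ⟨π, hπ⟩ := hp
  rw [Ideal.submodule_span_eq] at hπ
  have hmem : ∀ v : HeightOneSpectrum R, π ∈ v.asIdeal → v = v₀ := by
    intro v hv
    have h1 : v₀.asIdeal ^ Nat.card (ClassGroup R) ≤ v.asIdeal := by
      rw [hπ, Ideal.span_singleton_le_iff_mem]
      exact hv
    have h2 := Ideal.IsPrime.le_of_pow_le h1
    exact HeightOneSpectrum.ext (v₀.isMaximal.eq_of_le v.isPrime.ne_top h2).symm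
  have hπ₀ : π ∈ v₀.asIdeal := by
    have h1 : v₀.asIdeal ^ Nat.card (ClassGroup R) ≤ v₀.asIdeal :=
      Ideal.pow_le_self Nat.card_pos.ne'
    exact h1 (hπ ▸ Ideal.mem_span_singleton_self π)
  have hπ0 : π ≠ 0 := by
    rintro rfl
    refine pow_ne_zero (Nat.card (ClassGroup R)) v₀.ne_bot ?_
    rw [hπ]
    simp
  refine ⟨(algebraMap R F π)⁻¹, ?_, ?_⟩
  · rw [mem_placeOfPrime_ring, map_inv₀, not_le, one_lt_inv₀]
    · exact (v₀.valuation_lt_one_iff_mem π).2 hπ₀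
    · exact zero_lt_iff.2 ((Valuation.ne_zero_iff _).2
        ((map_ne_zero_iff _ (IsFractionRing.injective R F)).2 hπ0))
  · intro w hw hne
    obtain ⟨v, rfl⟩ := exists_placeOfPrime_eq (R := R) w fun r => hw r.2
    have h1 : π ∉ v.asIdeal := fun h => hne (by rw [hmem v h])
    rw [mem_placeOfPrime_ring, map_inv₀, (v.valuation_eq_one_iff_notMem).2 h1, inv_one]

variable {p : ℕ} [Fact p.Prime] [Algebra (ZMod p) F]

theorem aeval_div_aeval_mem_ring (w : FinitePlace F) {x : F} (hx : x ∉ w.ring)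
    {f g : (ZMod p)[X]} (hg : g ≠ 0) (h : f.degree < g.degree) :
    aeval x f / aeval x g ∈ w.ring := by
  set u := (IsDiscreteValuationRing.maximalIdeal w.ring).valuation F with hu
  have hle : ∀ z, u z ≤ 1 ↔ z ∈ w.ring := w.valuation_le_one_iff
  have hc : ∀ a : ZMod p, u (algebraMap (ZMod p) F a) ≤ 1 := fun a =>
    (hle _).2 (mem_ring_of_isAlgebraic (isAlgebraic_algebraMap a) w)
  have : u.IsTrivialOn (ZMod p) := ⟨fun a ha => by
    refine le_antisymm (hc a) ?_
    have h1 := hc a⁻¹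
    rw [map_inv₀, map_inv₀] at h1
    refine (inv_le_one₀ (zero_lt_iff.2 ((Valuation.ne_zero_iff _).2 ?_))).1 h1
    exact (map_ne_zero_iff _ (algebraMap (ZMod p) F).injective).2 ha⟩
  have hx1 : 1 < u x := not_le.1 fun h => hx ((hle x).1 h)
  by_cases hf : f = 0
  · rw [hf, map_zero, zero_div]
    exact zero_mem _
  rw [← hle, map_div₀, valuation_aeval_eq_valuation_X_pow_natDegree_of_one_lt_valuation_X x hx1 hf,
    valuation_aeval_eq_valuation_X_pow_natDegree_of_one_lt_valuation_X x hx1 hg]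
  refine (div_le_one₀ (pow_pos (zero_lt_one.trans hx1) _)).2 ?_
  exact pow_le_pow_right₀ hx1.le (natDegree_le_natDegree h.le)

/-- `F` is, up to finitely many elements, the sum of the ring `R` of elements integral over
`𝔽_p[x]` and of the elements without poles at the poles of `x`. -/
theorem exists_eq_add_of_span {R : Subring F} {x : F} (hx0 : x ≠ 0) {s : Finset F} 
    (hxR : x ∈ R) (hsR : ∀ b ∈ s, b ∈ R)
    (hden : ∀ z : F, ∃ f : (ZMod p)[X], f ≠ 0 ∧ aeval x f * z ∈ R)
    (hs : ∀ z ∈ R, ∃ f : F → (ZMod p)[X], z = ∑ b ∈ s, aeval x (f b) * b)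
    (hinj : ∀ f : (ZMod p)[X], f ≠ 0 → aeval x f ≠ 0) {M : ℕ}
    (hM : ∀ w : FinitePlace F, x ∉ w.ring → ∀ b ∈ s, b / x ^ M ∈ w.ring) (a : F) :
    ∃ g : s → degreeLT (ZMod p) M, ∃ r ∈ R, ∃ z : F,
      (∀ w : FinitePlace F, x ∉ w.ring → z ∈ w.ring) ∧
      a = r + ∑ b : s, aeval x (g b : (ZMod p)[X]) * (b / x ^ M) + z := by
  obtain ⟨v, hv, hva⟩ := hden a
  obtain ⟨u, hu⟩ := hs _ hva
  let q : F → (ZMod p)[X] := fun b => X ^ M * u b / v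
  let ρ : F → (ZMod p)[X] := fun b => X ^ M * u b % v
  have h1 : ∀ b, X ^ M * u b = v * (X ^ M * (q b / X ^ M) + q b % X ^ M) + ρ b := fun b => by
    rw [EuclideanDomain.div_add_mod, EuclideanDomain.div_add_mod]
  have haev : ∀ f : (ZMod p)[X], aeval x f ∈ R := by
    intro f
    rw [aeval_eq_sum_range]
    refine sum_mem fun i _ => ?_
    rw [Algebra.smul_def]
    refine mul_mem ?_ (pow_mem hxR i)
    rw [← ZMod.natCast_zmod_val (f.coeff i), map_natCast]
    exact natCast_mem R _
  refine ⟨fun b => ⟨q b % X ^ M, ?_⟩, ∑ b ∈ s, aeval x (q b / X ^ M) * b, ?_,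
    ∑ b ∈ s, aeval x (ρ b) / aeval x v * (b / x ^ M), ?_, ?_⟩
  · rw [mem_degreeLT]
    have := EuclideanDomain.mod_lt (q b) (b := (X ^ M : (ZMod p)[X])) (pow_ne_zero _ X_ne_zero)
    exact (this : degree _ < degree _).trans_eq (degree_X_pow M)
  · exact sum_mem fun b hb => mul_mem (haev _) (hsR b hb)
  · intro w hw
    refine sum_mem fun b hb => mul_mem ?_ (hM w hw b hb)
    exact aeval_div_aeval_mem_ring w hw hv (EuclideanDomain.mod_lt _ hv)
  · have hv0 := hinj v hv
    have hxM : x ^ M ≠ 0 := pow_ne_zero _ hx0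
    rw [Finset.sum_coe_sort s fun b => aeval x (q b % X ^ M) * (b / x ^ M),
      ← Finset.sum_add_distrib, ← Finset.sum_add_distrib]
    rw [← mul_right_inj' hv0, hu, Finset.mul_sum]
    refine Finset.sum_congr rfl fun b _ => ?_
    have h2 := congrArg (aeval x) (h1 b)
    simp only [map_mul, map_add, map_pow, aeval_X] at h2
    field_simp
    linear_combination b * h2

variable [Algebra.EssFiniteType (ZMod p) F] (htr : Algebra.trdeg (ZMod p) F = 1)
include htr

theorem exists_forall_mem_ring_iff_ne (w₀ : FinitePlace F) :
    ∃ c : F, c ∉ w₀.ring ∧ ∀ w : FinitePlace F, w ≠ w₀ → c ∈ w.ring := by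
  obtain ⟨x, hx, hxw₀⟩ : ∃ x : F, Transcendental (ZMod p) x ∧ x ∈ w₀.ring := by
    obtain ⟨x, hx⟩ := exists_transcendental_of_trdeg_eq_one htr
    rcases w₀.ring.mem_or_inv_mem x with h | h
    · exact ⟨x, hx, h⟩
    · exact ⟨x⁻¹, transcendental_inv hx, h⟩
  have hx0 : x ≠ 0 := by
    rintro rfl
    exact hx isAlgebraic_zero
  obtain ⟨R, hR, hxR, hRV, hden, s, hsR, hs⟩ := exists_arithmeticSubring_of_transcendental htr hx
  obtain ⟨y, hy₀, hy⟩ := exists_pole_of_arithmeticSubring hR w₀ (hRV _ hxw₀)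
  have hT : {w : FinitePlace F | x ∉ w.ring}.Finite := by
    refine (finite_setOf_ord_ne_zero_of_trdeg_eq_one htr (Units.mk0 x hx0)).subset fun w hw => ?_
    have h := (w.mem_ring_iff (Units.mk0 x hx0)).not.1 hw
    exact (not_le.1 h).ne
  obtain ⟨M, hM⟩ : ∃ M : ℕ, ∀ w : FinitePlace F, x ∉ w.ring → ∀ b ∈ s, b / x ^ M ∈ w.ring := by
    have hb : ∀ b ∈ s, ∀ w : FinitePlace F, x ∉ w.ring → ∃ m : ℕ, ∀ n ≥ m, b / x ^ n ∈ w.ring := by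
      intro b hb w hw
      by_cases hb0 : b = 0
      · exact ⟨0, fun n _ => by rw [hb0, zero_div]; exact zero_mem _⟩
      · refine ⟨(-w.ord (Units.mk0 b hb0)).toNat, fun n hn => ?_⟩
        have h := (w.mem_ring_iff (Units.mk0 x hx0)).not.1 hw
        refine w.div_mem_ring_of_ord_le (a := Units.mk0 x hx0 ^ n) (b := Units.mk0 b hb0) ?_
        rw [w.ord_pow]
        nlinarith [Int.self_le_toNat (-w.ord (Units.mk0 b hb0))]
    have hev : ∀ b ∈ s, ∀ w ∈ {w : FinitePlace F | x ∉ w.ring},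
        ∀ᶠ n in Filter.atTop, b / x ^ n ∈ w.ring := fun b hbs w hw =>
      Filter.eventually_atTop.2 (hb b hbs w hw)
    have hev2 := (Filter.eventually_all_finset s).2 fun b hbs =>
      (Filter.eventually_all_finite hT).2 (hev b hbs)
    obtain ⟨M, hM⟩ := hev2.exists
    exact ⟨M, fun w hw b hbs => hM b hbs w hw⟩
  have : Finite (degreeLT (ZMod p) M) := .of_equiv _ (degreeLTEquiv (ZMod p) M).symm.toEquiv
  have hdec := exists_eq_add_of_span hx0 hxR hsR hden hs
    (fun f hf h => hx ⟨f, hf, h⟩) hM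
  choose g r hr z hz h using fun N : ℕ => hdec (y ^ N)
  obtain ⟨m, n, hmn, hg⟩ : ∃ m n, m < n ∧ g m = g n := by
    obtain ⟨m, n, hne, hg⟩ := Finite.exists_ne_map_eq_of_infinite g
    rcases hne.lt_or_gt with h | h
    · exact ⟨m, n, h, hg⟩
    · exact ⟨n, m, h, hg.symm⟩
  have hc : z n - z m = y ^ n - y ^ m - (r n - r m) := by
    rw [h n, h m, hg]
    ring
  refine ⟨z n - z m, fun hmem => ?_, fun w hw => ?_⟩
  · have h1 : y ^ n - y ^ m ∈ w₀.ring := by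
      have h2 := add_mem hmem (sub_mem (hRV _ hxw₀ (hr n)) (hRV _ hxw₀ (hr m)))
      rwa [hc, sub_add_cancel] at h2
    rw [← w₀.ring.valuation_le_one_iff] at h1 hy₀
    rw [not_le] at hy₀
    have hlt : w₀.ring.valuation (y ^ m) < w₀.ring.valuation (y ^ n) := by
      rw [map_pow, map_pow]
      exact pow_lt_pow_right₀ hy₀ hmn
    rw [Valuation.map_sub_eq_of_lt_left _ hlt, map_pow] at h1
    exact (one_lt_pow₀ hy₀ (by omega)).not_ge h1
  · by_cases hxw : x ∈ w.ring
    · have hyw := hy w (hRV _ hxw) hw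
      rw [hc]
      exact sub_mem (sub_mem (pow_mem hyw n) (pow_mem hyw m))
        (sub_mem (hRV _ hxw (hr n)) (hRV _ hxw (hr m)))
    · exact sub_mem (hz n w hxw) (hz m w hxw)

theorem exists_arithmeticSubring_of_trdeg_eq_one (w₀ : FinitePlace F) :
    ∃ R : Subring F, IsArithmeticSubring R ∧
      ∀ w : FinitePlace F, w ≠ w₀ → R ≤ w.ring.toSubring := by
  obtain ⟨c, hc, h⟩ := exists_forall_mem_ring_iff_ne htr w₀
  have hct : Transcendental (ZMod p) c := fun h => hc (mem_ring_of_isAlgebraic h w₀)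
  obtain ⟨R, hR, -, hRV, -⟩ := exists_arithmeticSubring_of_transcendental htr hct
  exact ⟨R, hR, fun w hw => hRV _ (h w hw)⟩

end
end RayClass

namespace RayClass

open IsDedekindDomain WithZero Polynomial

section GlobalField

variable {F : Type*} [Field F]

theorem IsGlobalField.numberField_or_trdeg_eq_one (hF : IsGlobalField F) :
    NumberField F ∨ ∃ (p : ℕ) (_ : Fact p.Prime) (_ : Algebra (ZMod p) F),
      Algebra.EssFiniteType (ZMod p) F ∧ Algebra.trdeg (ZMod p) F = 1 := by
  refine hF.imp_right ?_
  rintro ⟨p, hp, hQ, hfin⟩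
  let : Algebra (ZMod p) F :=
    ((algebraMap (RatFunc (ZMod p)) F).comp (algebraMap (ZMod p) (RatFunc (ZMod p)))).toAlgebra
  have : IsScalarTower (ZMod p) (RatFunc (ZMod p)) F := .of_algebraMap_eq fun _ => rfl
  refine ⟨p, hp, inferInstance, ?_, ?_⟩
  · have : Algebra.EssFiniteType (ZMod p)[X] (RatFunc (ZMod p)) :=
      .of_isLocalization _ (nonZeroDivisors (ZMod p)[X])
    have : Algebra.EssFiniteType (ZMod p) (RatFunc (ZMod p)) := .comp _ (ZMod p)[X] _
    exact .comp _ (RatFunc (ZMod p)) _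
  · have h1 : Algebra.trdeg (ZMod p) (RatFunc (ZMod p)) = 1 := by
      have : Algebra.IsAlgebraic (ZMod p)[X] (RatFunc (ZMod p)) :=
        IsLocalization.isAlgebraic _ (nonZeroDivisors (ZMod p)[X])
      have h := trdeg_add_eq (ZMod p) (ZMod p)[X] (A := RatFunc (ZMod p))
      rw [trdeg_eq_zero (R := (ZMod p)[X]), trdeg_of_isDomain, add_zero] at h
      exact h.symm
    have h := lift_trdeg_add_eq (ZMod p) (RatFunc (ZMod p)) F
    rw [trdeg_eq_zero (R := RatFunc (ZMod p)), h1] at h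
    simpa using h.symm

theorem integralClosure_int_le_ring (w : FinitePlace F) :
    (integralClosure ℤ F).toSubring ≤ w.ring.toSubring := by
  intro x hx
  refine mem_valuationSubring_of_isIntegral (A := ℤ) w.ring (fun a => ?_) hx
  rw [algebraMap_int_eq, eq_intCast]
  exact intCast_mem w.ring a

theorem isArithmeticSubring_integralClosure_int [NumberField F] :
    IsArithmeticSubring (integralClosure ℤ F).toSubring where
  isDedekindDomain := inferInstanceAs (IsDedekindDomain (NumberField.RingOfIntegers F))
  isFractionRing := inferInstanceAs (IsFractionRing (NumberField.RingOfIntegers F) F)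
  hasFiniteQuotients := inferInstanceAs (Ring.HasFiniteQuotients (NumberField.RingOfIntegers F))
  finite_classGroup := inferInstanceAs (Finite (ClassGroup (NumberField.RingOfIntegers F)))

theorem IsGlobalField.finite_setOf_ord_ne_zero (hF : IsGlobalField F) (x : Fˣ) :
    {w : FinitePlace F | w.ord x ≠ 0}.Finite := by
  rcases hF.numberField_or_trdeg_eq_one with h | ⟨p, _, _, _, htr⟩
  · refine (finite_setOf_ord_ne_zero_of_dedekind (NumberField.RingOfIntegers F) x).subset
      fun w hw => ⟨fun r => integralClosure_int_le_ring w r.2, hw⟩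
  · exact finite_setOf_ord_ne_zero_of_trdeg_eq_one htr x

theorem isEmpty_infinitePlace_of_charP (p : ℕ) [Fact p.Prime] [Algebra (ZMod p) F] :
    IsEmpty (NumberField.InfinitePlace F) := by
  refine ⟨fun w => ?_⟩
  have : CharP F p := charP_of_injective_algebraMap (algebraMap (ZMod p) F).injective p
  have h : CharP ℂ p := charP_of_injective_ringHom w.embedding.injective p
  exact (Fact.out : p.Prime).ne_zero (CharP.eq ℂ h (CharP.ofCharZero ℂ))

theorem IsGlobalField.finite_infinitePlace (hF : IsGlobalField F) :
    Finite (NumberField.InfinitePlace F) := by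
  rcases hF.numberField_or_trdeg_eq_one with h | ⟨p, _, _, _, htr⟩
  · infer_instance
  · have := isEmpty_infinitePlace_of_charP (F := F) p
    infer_instance

/-- The ring of `S`-integers contains an arithmetic ring. -/
theorem IsGlobalField.exists_arithmeticSubring (hF : IsGlobalField F) {S : Set (Place F)}
    (hS : S.Nonempty) :
    ∃ R : Subring F, IsArithmeticSubring R ∧
      ∀ w : FinitePlace F, Sum.inl w ∉ S → R ≤ w.ring.toSubring := by
  rcases hF.numberField_or_trdeg_eq_one with h | ⟨p, _, _, _, htr⟩
  · exact ⟨_, isArithmeticSubring_integralClosure_int, fun w _ => integralClosure_int_le_ring w⟩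
  · have := isEmpty_infinitePlace_of_charP (F := F) p
    obtain ⟨w₀ | w₀, hw₀⟩ := hS
    · obtain ⟨R, hR, h⟩ := exists_arithmeticSubring_of_trdeg_eq_one htr w₀
      exact ⟨R, hR, fun w hw => h w fun e => hw (e ▸ hw₀)⟩
    · exact isEmptyElim w₀

theorem IsGlobalField.of_finiteDimensional {k K : Type*} [Field k] [Field K] [Algebra k K]
    [FiniteDimensional k K] (hk : IsGlobalField k) : IsGlobalField K := by
  rcases hk with h | ⟨p, hp, hQ, hfin⟩
  · exact Or.inl (NumberField.of_module_finite k K)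
  · let : Algebra (RatFunc (ZMod p)) K :=
      ((algebraMap k K).comp (algebraMap (RatFunc (ZMod p)) k)).toAlgebra
    have : IsScalarTower (RatFunc (ZMod p)) k K := .of_algebraMap_eq fun _ => rfl
    exact Or.inr ⟨p, hp, inferInstance, FiniteDimensional.trans _ k K⟩

variable (F) in
/-- The group of the elements that are units at all finite places. -/
def everywhereUnits : Subgroup Fˣ := ⨅ w : FinitePlace F, w.ordHom.ker

theorem mem_everywhereUnits {x : Fˣ} : x ∈ everywhereUnits F ↔ ∀ w : FinitePlace F, w.ord x = 0 := by
  simp only [everywhereUnits, Subgroup.mem_iInf, MonoidHom.mem_ker, FinitePlace.ord, toAdd_eq_zero]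

theorem IsGlobalField.finite_everywhereUnits (hF : IsGlobalField F) :
    Module.Finite ℤ (Additive (everywhereUnits F)) := by
  rcases hF.numberField_or_trdeg_eq_one with h | ⟨p, _, _, _, htr⟩
  · let f : (NumberField.RingOfIntegers F)ˣ →* Fˣ :=
      Units.map (algebraMap (NumberField.RingOfIntegers F) F : _ →* F)
    have hmem : ∀ x : Fˣ, x ∈ everywhereUnits F → ∃ r, algebraMap (NumberField.RingOfIntegers F) F r = x := by
      intro x hx
      refine exists_algebraMap_eq_of_forall_mem _ fun w _ => ?_
      rw [w.mem_ring_iff, mem_everywhereUnits.1 hx]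
    have hle : everywhereUnits F ≤ f.range := by
      intro x hx
      obtain ⟨r, hr⟩ := hmem x hx
      obtain ⟨s, hs⟩ := hmem x⁻¹ (inv_mem hx)
      have hrs : r * s = 1 := by
        apply IsFractionRing.injective (NumberField.RingOfIntegers F) F
        rw [map_mul, hr, hs, map_one, ← Units.val_mul, mul_inv_cancel, Units.val_one]
      exact ⟨⟨r, s, hrs, by rw [mul_comm, hrs]⟩, Units.ext hr⟩
    have h1 : Module.Finite ℤ (Additive (NumberField.RingOfIntegers F)ˣ) := inferInstance
    have h2 : Module.Finite ℤ (Additive f.range) :=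
      .of_surjective (MonoidHom.toAdditive f.rangeRestrict).toIntLinearMap
        f.rangeRestrict_surjective
    exact .of_injective (MonoidHom.toAdditive (Subgroup.inclusion hle)).toIntLinearMap
      (Subgroup.inclusion_injective hle)
  · have hne : Nonempty (FinitePlace F) := by
      by_contra hne
      obtain ⟨x, hx⟩ := exists_transcendental_of_trdeg_eq_one htr
      exact hx (isAlgebraic_of_forall_mem_ring htr fun w => (hne ⟨w⟩).elim)
    have hfin : Finite (everywhereUnits F) := by
      have := (finite_setOf_isAlgebraic_of_finitePlace htr (Classical.arbitrary _)).to_subtype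
      refine Finite.of_injective (β := {x : F | IsAlgebraic (ZMod p) x})
        (fun x => ⟨(x : Fˣ), isAlgebraic_of_forall_mem_ring htr fun w => ?_⟩) ?_
      · rw [w.mem_ring_iff, mem_everywhereUnits.1 x.2]
      · intro x y hxy
        exact Subtype.ext (Units.ext (congrArg Subtype.val hxy))
    have : Finite (Additive (everywhereUnits F)) := hfin
    infer_instance

end GlobalField
end RayClass

namespace RayClass

open IsDedekindDomain WithZero nonZeroDivisors

section

variable {F : Type*} [Field F]

section Dedekind

variable {R : Type*} [CommRing R] [IsDedekindDomain R] [Algebra R F] [IsFractionRing R F]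

theorem ord_placeOfPrime_algebraMap (v : HeightOneSpectrum R) (x : Fˣ) (r : R)
    (h : algebraMap R F r = x) :
    (placeOfPrime F v).ord x = FractionalIdeal.count F v (Ideal.span {r} : Ideal R) := by
  have hr : r ≠ 0 := by
    rintro rfl
    rw [map_zero] at h
    exact x.ne_zero h.symm
  have hI : Ideal.span {r} ≠ 0 := by simpa using hr
  have h1 := valuation_eq_exp_neg_ord_placeOfPrime v x
  rw [← h, v.valuation_of_algebraMap, v.intValuation_if_neg hr, exp_inj, neg_inj] at h1
  rw [FractionalIdeal.count_coe F v hI, h1]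

theorem ord_placeOfPrime_eq_count (v : HeightOneSpectrum R) (x : Fˣ) :
    (placeOfPrime F v).ord x = FractionalIdeal.count F v (FractionalIdeal.spanSingleton R⁰ (x : F)) := by
  obtain ⟨r, s, hs, hrs⟩ := IsFractionRing.div_surjective (A := R) (x : F)
  have hs0 : algebraMap R F s ≠ 0 :=
    (map_ne_zero_iff _ (IsFractionRing.injective R F)).2 (nonZeroDivisors.ne_zero hs)
  have hr : algebraMap R F r = x * algebraMap R F s := by rw [← hrs, div_mul_cancel₀ _ hs0]
  have h1 := ord_placeOfPrime_algebraMap v (Units.mk0 _ hs0) s rfl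
  have h2 := ord_placeOfPrime_algebraMap v (x * Units.mk0 _ hs0) r hr
  rw [FractionalIdeal.coeIdeal_span_singleton] at h1 h2
  rw [hr, ← FractionalIdeal.spanSingleton_mul_spanSingleton, FractionalIdeal.count_mul,
    FinitePlace.ord_mul, h1] at h2
  · exact add_right_cancel h2
  · exact FractionalIdeal.spanSingleton_ne_zero_iff.2 x.ne_zero
  · exact FractionalIdeal.spanSingleton_ne_zero_iff.2 hs0

variable (F) in
/-- The fractional ideal `∏ v ^ D v`. -/
def fractionalIdealOfDivisor (D : HeightOneSpectrum R →₀ ℤ) : (FractionalIdeal R⁰ F)ˣ :=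
  Units.mk0 (D.prod fun v n => (v.asIdeal : FractionalIdeal R⁰ F) ^ n) <|
    Finset.prod_ne_zero_iff.2 fun v _ => zpow_ne_zero _
      (FractionalIdeal.coeIdeal_ne_zero.2 v.ne_bot)

theorem count_fractionalIdealOfDivisor (D : HeightOneSpectrum R →₀ ℤ) (v : HeightOneSpectrum R) :
    FractionalIdeal.count F v (fractionalIdealOfDivisor F D : FractionalIdeal R⁰ F) = D v :=
  FractionalIdeal.count_finsuppProd F v D

theorem exists_forall_ord_eq_sub_of_mk_eq {D D' : HeightOneSpectrum R →₀ ℤ}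
    (h : ClassGroup.mk F (fractionalIdealOfDivisor F D) =
      ClassGroup.mk F (fractionalIdealOfDivisor F D')) :
    ∃ x : Fˣ, ∀ v, (placeOfPrime F v).ord x = D v - D' v := by
  rw [← div_eq_one, ← map_div, ClassGroup.mk_eq_one_iff] at h
  obtain ⟨x, hx⟩ := (FractionalIdeal.isPrincipal_iff _).1 h
  have hx0 : x ≠ 0 := by
    rintro rfl
    rw [FractionalIdeal.spanSingleton_zero] at hx
    exact Units.ne_zero _ hx
  refine ⟨Units.mk0 x hx0, fun v => ?_⟩
  rw [ord_placeOfPrime_eq_count, Units.val_mk0, ← hx, div_eq_mul_inv, Units.val_mul,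
    FractionalIdeal.count_mul _ _ (Units.ne_zero _) (Units.ne_zero _),
    Units.val_inv_eq_inv_val, FractionalIdeal.count_inv, count_fractionalIdealOfDivisor,
    count_fractionalIdealOfDivisor, sub_eq_add_neg]

end Dedekind

@[to_additive finite_addQuotient_of_forall_eq]
theorem finite_quotient_of_forall_eq {A T : Type*} [Group A] [Finite T] (H : Subgroup A)
    (f : A → T) (hf : ∀ a b, f a = f b → a⁻¹ * b ∈ H) : Finite (A ⧸ H) := by
  refine Finite.of_injective (fun q : A ⧸ H => f q.out) fun q q' h => ?_
  rw [← q.out_eq, ← q'.out_eq]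
  exact QuotientGroup.eq.2 (hf _ _ h)

namespace SModulus

variable {S : Set (Place F)} (m : SModulus S)

theorem exists_mem_fin_ne_zero : ∃ a ∈ m.fin, (a : F) ≠ 0 := by
  obtain ⟨a, ha, h0⟩ := Submodule.exists_mem_ne_zero_of_ne_bot m.fin_ne_bot
  exact ⟨a, ha, fun h => h0 (Subtype.ext h)⟩

theorem exists_localIdeal_eq {w : FinitePlace F} (hw : Sum.inl w ∉ S) :
    ∃ a : Fˣ, (∃ b ∈ m.fin, (b : F) = a) ∧ ∀ x : F, x ∈ m.localIdeal w ↔ x / a ∈ w.ring := by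
  have hne : ∃ n : ℕ, ∃ a : Fˣ, (∃ b ∈ m.fin, (b : F) = a) ∧ w.ord a = n := by
    obtain ⟨a, ha, h0⟩ := m.exists_mem_fin_ne_zero
    refine ⟨(w.ord (Units.mk0 a h0)).toNat, Units.mk0 a h0, ⟨a, ha, rfl⟩, ?_⟩
    exact (Int.toNat_of_nonneg ((w.mem_ring_iff (Units.mk0 a h0)).1 (a.2 w hw))).symm
  classical
  obtain ⟨a, ha, hn⟩ := Nat.find_spec hne
  refine ⟨a, ha, fun x => ⟨fun hx => ?_, fun hx => ?_⟩⟩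
  · induction hx using Submodule.span_induction with
    | mem x hx =>
      obtain ⟨b, hb, rfl⟩ := hx
      by_cases hb0 : (b : F) = 0
      · rw [hb0, zero_div]
        exact zero_mem _
      · refine w.div_mem_ring_of_ord_le (b := Units.mk0 (b : F) hb0) ?_
        have h1 := (w.mem_ring_iff (Units.mk0 (b : F) hb0)).1 (b.2 w hw)
        have h2 := Nat.find_min' hne ⟨Units.mk0 (b : F) hb0, ⟨b, hb, rfl⟩,
          (Int.toNat_of_nonneg h1).symm⟩
        omega
    | zero => rw [zero_div]; exact zero_mem _
    | add x y _ _ hx hy => rw [add_div]; exact add_mem hx hy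
    | smul c x _ hx =>
      rw [show c • x = (c : F) * x from rfl, mul_div_assoc]
      exact mul_mem c.2 hx
  · obtain ⟨b, hb, hba⟩ := ha
    have h := Submodule.smul_mem (m.localIdeal w) (⟨x / a, hx⟩ : w.ring)
      (Submodule.subset_span ⟨b, hb, rfl⟩)
    rw [hba, show (⟨x / a, hx⟩ : w.ring) • (a : F) = x / a * a from rfl,
      div_mul_cancel₀ _ a.ne_zero] at h
    exact h

/-- The elements of `Fˣ` that are units at all places dividing `𝔪_f`. -/
def localUnits : Subgroup Fˣ where
  carrier := {x | ∀ w, m.FinDvd w → w.ord x = 0}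
  one_mem' w _ := w.ord_one
  mul_mem' hx hy w hw := by rw [w.ord_mul, hx w hw, hy w hw, add_zero]
  inv_mem' hx w hw := by rw [w.ord_inv, hx w hw, neg_zero]

theorem ord_eq_zero_of_mem_rayGroup {x : Fˣ} (hx : x ∈ m.rayGroup) {w : FinitePlace F}
    (hw : m.FinDvd w) : w.ord x = 0 := by
  have h1 := (w.mem_ring_iff x).1 (m.mem_ring_of_sub_one_mem hw (hx.1 w hw))
  have h2 := m.inv_mem_ring_of_sub_one_mem hw (hx.1 w hw)
  rw [← Units.val_inv_eq_inv_val, w.mem_ring_iff, w.ord_inv] at h2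
  omega

theorem rayGroup_le_localUnits : m.rayGroup ≤ m.localUnits := fun _ hx _ hw =>
  m.ord_eq_zero_of_mem_rayGroup hx hw

variable (hF : IsGlobalField F)
include hF

theorem finite_setOf_finDvd : {w | m.FinDvd w}.Finite := by
  obtain ⟨a, ha, h0⟩ := m.exists_mem_fin_ne_zero
  refine (hF.finite_setOf_ord_ne_zero (Units.mk0 a h0)).subset fun w hw => ?_
  exact ((w.mem_nonunits_iff (Units.mk0 (a : F) h0)).1 (hw.2 a ha)).ne'

variable (hS : S.Nonempty)
include hS

theorem finite_localUnits_quotient :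
    Finite (m.localUnits ⧸ m.rayGroup.subgroupOf m.localUnits) := by
  classical
  obtain ⟨R, hR, hRS⟩ := hF.exists_arithmeticSubring hS
  have := hR.isDedekindDomain
  have := hR.isFractionRing
  have := hR.hasFiniteQuotients
  have := hF.finite_infinitePlace
  have := (m.finite_setOf_finDvd hF).to_subtype
  have h : ∀ w : {w | m.FinDvd w}, ∃ a : Fˣ,
      (∀ x : F, x ∈ m.localIdeal w ↔ x / a ∈ w.1.ring) ∧
      ∃ T : Set F, T.Finite ∧ ∀ x ∈ w.1.ring, ∃ t ∈ T, (x - t) / a ∈ w.1.ring := by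
    intro w
    obtain ⟨a, -, ha⟩ := m.exists_localIdeal_eq w.2.1
    exact ⟨a, ha, exists_finite_forall_sub_div_mem R w.1 (fun r => hRS w.1 w.2.1 r.2) a⟩
  choose a ha T hT h using h
  choose! t ht h using h
  have := fun w => (hT w).to_subtype
  have hmem : ∀ (x : m.localUnits) (w : {w | m.FinDvd w}), ((x : Fˣ) : F) ∈ w.1.ring := fun x w =>
    (w.1.mem_ring_iff _).2 (x.2 w.1 w.2).ge
  refine finite_quotient_of_forall_eq (T := (∀ w : {w | m.FinDvd w}, T w) × (m.inf → Prop)) _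
    (fun x => ⟨fun w => ⟨t w (x : Fˣ), ht w _ (hmem x w)⟩, fun w =>
      0 < NumberField.InfinitePlace.embedding_of_isReal (m.isReal w.1 w.2) ((x : Fˣ) : F)⟩)
    fun x y hxy => Subgroup.mem_subgroupOf.2 ⟨fun w hw => ?_, fun w hw => ?_⟩
  · have h1 := congrArg Subtype.val (congrFun (congrArg Prod.fst hxy) ⟨w, hw⟩)
    have h2 := sub_mem (h ⟨w, hw⟩ _ (hmem y ⟨w, hw⟩)) (h ⟨w, hw⟩ _ (hmem x ⟨w, hw⟩))
    simp only at h1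
    rw [h1, ← sub_div, sub_sub_sub_cancel_right] at h2
    rw [ha ⟨w, hw⟩]
    have h3 := mul_mem (hmem x⁻¹ ⟨w, hw⟩) h2
    have hx0 := (x : Fˣ).ne_zero
    convert h3 using 1
    push_cast
    field_simp
  · have h1 := congrFun (congrArg Prod.snd hxy) ⟨w, hw⟩
    simp only [eq_iff_iff] at h1
    rw [Subgroup.coe_mul, Subgroup.coe_inv, Units.val_mul, map_mul, Units.val_inv_eq_inv_val,
      map_inv₀]
    set φ := NumberField.InfinitePlace.embedding_of_isReal (m.isReal w hw)
    have hx0 : φ ((x : Fˣ) : F) ≠ 0 := (map_ne_zero φ).2 (x : Fˣ).ne_zero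
    have hy0 : φ ((y : Fˣ) : F) ≠ 0 := (map_ne_zero φ).2 (y : Fˣ).ne_zero
    rcases hx0.lt_or_gt with hx | hx
    · have hy : φ ((y : Fˣ) : F) < 0 := hy0.lt_of_le (not_lt.1 fun hy => hx.not_gt (h1.2 hy))
      exact mul_pos_of_neg_of_neg (inv_lt_zero.2 hx) hy
    · exact mul_pos (inv_pos.2 hx) (h1.1 hx)

/-- The ray class groups of a global field are finite. -/
theorem finite_classGroup : Finite m.ClassGroup := by
  classical
  obtain ⟨R, hR, hRS⟩ := hF.exists_arithmeticSubring hS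
  have := hR.isDedekindDomain
  have := hR.isFractionRing
  have := hR.finite_classGroup
  have := m.finite_localUnits_quotient hF hS
  let res : (FinitePlace F →₀ ℤ) → (HeightOneSpectrum R →₀ ℤ) := fun D =>
    D.comapDomain (placeOfPrime F) placeOfPrime_injective.injOn
  let cl : m.divisorGroup → _root_.ClassGroup R := fun D =>
    _root_.ClassGroup.mk F (fractionalIdealOfDivisor F (res D.1))
  let rep : _root_.ClassGroup R → m.divisorGroup := fun c => if h : ∃ D, cl D = c then h.choose else 0
  have hrep : ∀ D, cl (rep (cl D)) = cl D := fun D => by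
    have h : ∃ D', cl D' = cl D := ⟨D, rfl⟩
    simp only [rep, dif_pos h]
    exact h.choose_spec
  have hx : ∀ D : m.divisorGroup, ∃ x : m.localUnits, ∀ w : FinitePlace F, Sum.inl w ∉ S →
      w.ord (x : Fˣ) = D.1 w - (rep (cl D)).1 w := by
    intro D
    obtain ⟨x, hx⟩ := exists_forall_ord_eq_sub_of_mk_eq (F := F) (hrep D).symm
    have hx' : ∀ w : FinitePlace F, Sum.inl w ∉ S → w.ord x = D.1 w - (rep (cl D)).1 w := by
      intro w hw
      obtain ⟨v, rfl⟩ := exists_placeOfPrime_eq (R := R) w fun r => hRS w hw r.2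
      exact hx v
    refine ⟨⟨x, fun w hw => ?_⟩, hx'⟩
    rw [hx' w hw.1, D.2 w (Or.inr hw), (rep (cl D)).2 w (Or.inr hw), sub_zero]
  choose x hx using hx
  refine finite_addQuotient_of_forall_eq _ (fun D => (cl D,
    (x D : m.localUnits ⧸ m.rayGroup.subgroupOf m.localUnits))) fun D D' h => ?_
  obtain ⟨h1, h2⟩ := Prod.ext_iff.1 h
  have h3 : (x D)⁻¹ * x D' ∈ m.rayGroup.subgroupOf m.localUnits := QuotientGroup.eq.1 h2
  refine ⟨_, h3, fun w hw => ?_⟩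
  rw [Subgroup.coe_subtype, Subgroup.coe_mul, Subgroup.coe_inv, w.ord_mul, w.ord_inv, hx D w hw, hx D' w hw, show cl D = cl D' from h1]
  change -D.1 w + D'.1 w = _
  ring

theorem finite_quotient_rayGroup :
    Module.Finite ℤ (Additive Fˣ ⧸ (Subgroup.toAddSubgroup m.rayGroup).toIntSubmodule) := by
  have := (m.finite_setOf_finDvd hF).to_subtype
  have := m.finite_localUnits_quotient hF hS
  set M := (Subgroup.toAddSubgroup m.rayGroup).toIntSubmodule with hM
  let f : Additive Fˣ →ₗ[ℤ] ({w | m.FinDvd w} → ℤ) :=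
    AddMonoidHom.toIntLinearMap
      { toFun := fun x w => w.1.ord (Additive.toMul x)
        map_zero' := funext fun w => w.1.ord_one
        map_add' := fun x y => funext fun w => w.1.ord_mul _ _ }
  have hMf : M ≤ LinearMap.ker f := fun x hx =>
    LinearMap.mem_ker.2 (funext fun w => m.rayGroup_le_localUnits hx w.1 w.2)
  let g : (Additive Fˣ ⧸ M) →ₗ[ℤ] ({w | m.FinDvd w} → ℤ) := M.liftQ f hMf
  have hfin : Finite (LinearMap.ker g) := by
    have hmem : ∀ x : LinearMap.ker g, Additive.toMul (Quotient.out x.1) ∈ m.localUnits := by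
      intro x w hw
      have h1 : g (Submodule.Quotient.mk (Quotient.out x.1)) = 0 := by
        rw [show Submodule.Quotient.mk (Quotient.out x.1) = x.1 from Quotient.out_eq x.1]
        exact x.2
      exact congrFun h1 ⟨w, hw⟩
    refine Finite.of_injective (β := m.localUnits ⧸ m.rayGroup.subgroupOf m.localUnits)
      (fun x => QuotientGroup.mk ⟨_, hmem x⟩) fun x y h => ?_
    have h1 : (⟨_, hmem x⟩ : m.localUnits)⁻¹ * ⟨_, hmem y⟩ ∈ m.rayGroup.subgroupOf m.localUnits :=
      QuotientGroup.eq.1 h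
    apply Subtype.ext
    rw [← Quotient.out_eq x.1, ← Quotient.out_eq y.1]
    refine ((Submodule.Quotient.eq M).2 ?_).symm
    rw [sub_eq_neg_add]
    exact h1
  suffices IsNoetherian ℤ (Additive Fˣ ⧸ M) from inferInstance
  exact isNoetherian_of_range_eq_ker (LinearMap.ker g).subtype g (Submodule.range_subtype _)

omit hS in
/-- The `S`-unit theorem: finite generation of the `S`-units. -/
theorem finite_unitGroup (hSf : S.Finite) : Module.Finite ℤ (Additive m.unitGroup) := by
  have hSf' : {w : FinitePlace F | Sum.inl w ∈ S}.Finite :=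
    hSf.preimage Sum.inl_injective.injOn
  have := hSf'.to_subtype
  have := hF.finite_everywhereUnits
  let f : Additive m.unitGroup →ₗ[ℤ] ({w : FinitePlace F | Sum.inl w ∈ S} → ℤ) :=
    AddMonoidHom.toIntLinearMap
      { toFun := fun x w => w.1.ord (Additive.toMul x : m.unitGroup)
        map_zero' := funext fun w => w.1.ord_one
        map_add' := fun x y => funext fun w => w.1.ord_mul _ _ }
  have hker : ∀ x : Additive m.unitGroup, x ∈ LinearMap.ker f →
      ((Additive.toMul x : m.unitGroup) : Fˣ) ∈ everywhereUnits F := by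
    intro x hx
    rw [mem_everywhereUnits]
    intro w
    by_cases hw : Sum.inl w ∈ S
    · exact congrFun (LinearMap.mem_ker.1 hx) ⟨w, hw⟩
    · have h1 := (w.mem_ring_iff _).1 ((Additive.toMul x).2.1.1 w hw)
      have h2 := (w.mem_ring_iff _).1 ((Additive.toMul x).2.1.2 w hw)
      rw [w.ord_inv] at h2
      omega
  let g : LinearMap.ker f →ₗ[ℤ] Additive (everywhereUnits F) :=
    AddMonoidHom.toIntLinearMap
      { toFun := fun x => Additive.ofMul ⟨_, hker x.1 x.2⟩
        map_zero' := rfl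
        map_add' := fun _ _ => rfl }
  have hg : Function.Injective g := by
    intro x y h
    have h1 := congrArg (fun z => ((Additive.toMul z : everywhereUnits F) : Fˣ)) h
    exact Subtype.ext (Subtype.ext h1)
  have : Module.Finite ℤ (LinearMap.ker f) := Module.Finite.of_injective g hg
  suffices IsNoetherian ℤ (Additive m.unitGroup) from inferInstance
  exact isNoetherian_of_range_eq_ker (LinearMap.ker f).subtype f (Submodule.range_subtype _)

end SModulus
end
end RayClass

namespace RayClass

open IsDedekindDomain WithZero

section Extension

variable {k K : Type*} [Field k] [Field K] [Algebra k K]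

theorem mem_nonunits_placeOfPrime_iff {R : Type*} [CommRing R] [IsDedekindDomain R] [Algebra R K]
    [IsFractionRing R K] (v : HeightOneSpectrum R) (r : R) :
    algebraMap R K r ∈ (placeOfPrime K v).ring.nonunits ↔ r ∈ v.asIdeal := by
  rw [← v.valuation_lt_one_iff_mem (K := K)]
  by_cases hr : algebraMap R K r = 0
  · refine iff_of_true (by rw [ValuationSubring.mem_nonunits_iff_or]; exact Or.inl hr) ?_
    change v.valuation K (algebraMap R K r) < 1
    rw [hr, map_zero]
    exact zero_lt_one
  · have h1 := (placeOfPrime K v).mem_nonunits_iff (Units.mk0 _ hr)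
    have h2 := valuation_eq_exp_neg_ord_placeOfPrime v (Units.mk0 _ hr)
    rw [Units.val_mk0] at h1 h2
    rw [h1, h2, ← exp_zero, exp_lt_exp, neg_lt_zero]

namespace FinitePlace

section Algebraic

variable [Algebra.IsAlgebraic k K]

variable (k) in
theorem exists_algebraMap_notMem_ring (w : FinitePlace K) : ∃ a : k, algebraMap k K a ∉ w.ring := by
  by_contra! h
  refine w.ring_ne_top (top_le_iff.1 fun x _ => ?_)
  exact mem_valuationSubring_of_isIntegral w.ring h
    (Algebra.IsAlgebraic.isAlgebraic (R := k) x).isIntegral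

variable (k) in
/-- The place of `k` below a finite place of `K`. -/
def under (w : FinitePlace K) : FinitePlace k where
  ring := w.ring.comap (algebraMap k K)
  isDVR := w.isDVR_comap (w.exists_algebraMap_notMem_ring k).choose_spec

theorem mem_under_ring (w : FinitePlace K) (a : k) :
    a ∈ (w.under k).ring ↔ algebraMap k K a ∈ w.ring := Iff.rfl

theorem liesOver_iff (w : FinitePlace K) (v : FinitePlace k) :
    LiesOver (Sum.inl w) (Sum.inl v) ↔ w.under k = v :=
  ⟨fun h => FinitePlace.ext h, fun h => h ▸ rfl⟩

theorem under_smul (σ : K ≃ₐ[k] K) (w : FinitePlace K) : (σ • w).under k = w.under k := by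
  rw [← liesOver_iff, liesOver_smul, liesOver_iff]

theorem inl_mem_placesOver {S : Set (Place k)} (w : FinitePlace K) :
    Sum.inl w ∈ placesOver K S ↔ Sum.inl (w.under k) ∈ S := by
  constructor
  · rintro ⟨v | v, hv, h⟩
    · rw [liesOver_iff] at h
      rwa [h]
    · exact h.elim
  · exact fun h => ⟨_, h, (liesOver_iff _ _).2 rfl⟩

theorem ord_map_eq (w : FinitePlace K) {π : k} (hπ0 : π ≠ 0)
    (hπ : (w.under k).ord (Units.mk0 π hπ0) = 1) (x : kˣ) :
    w.ord (Units.map (algebraMap k K : k →* K) x) =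
      w.ord (Units.map (algebraMap k K : k →* K) (Units.mk0 π hπ0)) * (w.under k).ord x := by
  have hunit : ∀ y : kˣ, (w.under k).ord y = 0 →
      w.ord (Units.map (algebraMap k K : k →* K) y) = 0 := by
    intro y hy
    have h1 := (w.mem_ring_iff (Units.map (algebraMap k K : k →* K) y)).1
      (((w.under k).mem_ring_iff y).2 hy.ge)
    have h2 := (w.mem_ring_iff (Units.map (algebraMap k K : k →* K) y⁻¹)).1
      (((w.under k).mem_ring_iff y⁻¹).2 (by rw [ord_inv, hy, neg_zero]))
    rw [map_inv, ord_inv] at h2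
    omega
  have h := hunit (x * Units.mk0 π hπ0 ^ (-(w.under k).ord x)) (by
    rw [ord_mul, ord_zpow, hπ]; ring)
  rw [map_mul, ord_mul, map_zpow, ord_zpow] at h
  linarith

variable (k) in
theorem ord_map_eq_and_pos (w : FinitePlace K) : 0 < ramificationIndexAt k w ∧
    ∀ x : kˣ, w.ord (Units.map (algebraMap k K : k →* K) x) =
      ramificationIndexAt k w * (w.under k).ord x := by
  obtain ⟨π, hπ⟩ := (w.under k).exists_ord_eq_one
  have hord := w.ord_map_eq π.ne_zero (by rwa [Units.mk0_val])
  rw [Units.mk0_val] at hord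
  set e := w.ord (Units.map (algebraMap k K : k →* K) π) with he
  have hpos : 0 < e := by
    have h : ((π : kˣ) : k) ∈ (w.under k).ring.nonunits := by
      rw [mem_nonunits_iff, hπ]
      exact zero_lt_one
    rw [ValuationSubring.mem_nonunits_iff_or, or_iff_right π.ne_zero, mem_under_ring,
      map_inv₀] at h
    rw [he, ← mem_nonunits_iff, ValuationSubring.mem_nonunits_iff_or]
    exact Or.inr h
  have hrange : (w.ordHom.comp (Units.map (algebraMap k K : k →* K))).range =
      Subgroup.zpowers (Multiplicative.ofAdd e) := by
    ext n
    rw [Subgroup.mem_zpowers_iff]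
    constructor
    · rintro ⟨x, rfl⟩
      refine ⟨(w.under k).ord x, ?_⟩
      rw [← ofAdd_zsmul, smul_eq_mul, mul_comm, ← hord]
      rfl
    · rintro ⟨n, rfl⟩
      refine ⟨π ^ n, ?_⟩
      rw [map_zpow]
      rfl
  have hidx : ramificationIndexAt k w = e.natAbs := by
    rw [ramificationIndexAt, hrange]
    exact Int.index_zmultiples e
  have hcast : (ramificationIndexAt k w : ℤ) = e := by
    rw [hidx, Int.natCast_natAbs, abs_of_pos hpos]
  refine ⟨by omega, fun x => ?_⟩
  rw [hcast, hord]

variable (k) in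
theorem ramificationIndexAt_pos (w : FinitePlace K) : 0 < ramificationIndexAt k w :=
  (w.ord_map_eq_and_pos k).1

theorem ord_map (w : FinitePlace K) (x : kˣ) :
    w.ord (Units.map (algebraMap k K : k →* K) x) =
      ramificationIndexAt k w * (w.under k).ord x :=
  (w.ord_map_eq_and_pos k).2 x

theorem ramificationIndexAt_smul (σ : K ≃ₐ[k] K) (w : FinitePlace K) :
    ramificationIndexAt k (σ • w) = ramificationIndexAt k w := by
  obtain ⟨π, hπ⟩ := (w.under k).exists_ord_eq_one
  have h1 := ord_map w π
  have h2 := ord_map (σ • w) π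
  rw [under_smul, hπ, mul_one] at h2
  rw [hπ, mul_one] at h1
  have h3 : σ • Units.map (algebraMap k K : k →* K) π = Units.map (algebraMap k K : k →* K) π :=
    Units.ext (σ.commutes π)
  have h4 := ord_smul σ w (Units.map (algebraMap k K : k →* K) π)
  rw [h3, h1, h2] at h4
  exact_mod_cast h4

end Algebraic

variable [FiniteDimensional k K] [IsGalois k K]

theorem exists_under_eq (v : FinitePlace k) : ∃ w : FinitePlace K, w.under k = v := by
  let B := integralClosure v.ring K
  have : IsFractionRing B K := integralClosure.isFractionRing_of_finite_extension k K
  have : IsDedekindDomain B := integralClosure.isDedekindDomain v.ring k K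
  obtain ⟨π, hπ⟩ := v.exists_ord_eq_one
  have hB : ∃ w : FinitePlace K, (∀ b : B, algebraMap B K b ∈ w.ring) ∧
      algebraMap k K (π⁻¹ : kˣ) ∉ w.ring := by
    by_contra! h
    obtain ⟨b, hb⟩ := exists_algebraMap_eq_of_forall_mem B h
    have hint : IsIntegral v.ring (algebraMap k K (π⁻¹ : kˣ)) := hb ▸ b.2
    rw [isIntegral_algebraMap_iff (algebraMap k K).injective] at hint
    obtain ⟨y, hy⟩ := IsIntegrallyClosed.isIntegral_iff.1 hint
    have h2 : ((π⁻¹ : kˣ) : k) ∈ v.ring := hy ▸ y.2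
    rw [v.mem_ring_iff, v.ord_inv, hπ] at h2
    omega
  obtain ⟨w, hw, -⟩ := hB
  refine ⟨w, FinitePlace.ext (ValuationSubring.eq_of_le_of_ne_top _ ?_ (w.under k).ring_ne_top).symm⟩
  intro a ha
  exact hw (algebraMap v.ring B ⟨a, ha⟩)

theorem exists_smul_eq_of_under_eq {w w' : FinitePlace K} (h : w.under k = w'.under k) :
    ∃ σ : K ≃ₐ[k] K, σ • w = w' := by
  set v := w.under k with hv
  let B := integralClosure v.ring K
  have : IsFractionRing B K := integralClosure.isFractionRing_of_finite_extension k K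
  have : IsDedekindDomain B := integralClosure.isDedekindDomain v.ring k K
  have hBw : ∀ u : FinitePlace K, u.under k = v → ∀ b : B, algebraMap B K b ∈ u.ring := by
    intro u hu b
    refine mem_valuationSubring_of_isIntegral (A := v.ring) u.ring (fun a => ?_) b.2
    have ha : (a : k) ∈ (u.under k).ring := by rw [hu]; exact a.2
    exact ha
  obtain ⟨P, hP⟩ := exists_placeOfPrime_eq w (hBw w rfl)
  obtain ⟨P', hP'⟩ := exists_placeOfPrime_eq w' (hBw w' h.symm)
  have hunder : ∀ P : HeightOneSpectrum B, P.asIdeal.under v.ring =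
      IsLocalRing.maximalIdeal v.ring := by
    intro P
    have h1 : P.asIdeal.under v.ring ≠ ⊥ := Ideal.under_ne_bot v.ring P.ne_bot
    exact IsLocalRing.eq_maximalIdeal (Ring.DimensionLEOne.maximalOfPrime h1 inferInstance)
  have hinv : Algebra.IsInvariant v.ring B (B ≃ₐ[v.ring] B) :=
    Algebra.isInvariant_of_isGalois' v.ring k K B
  have : Finite (B ≃ₐ[v.ring] B) := .of_equiv _ (galRestrict v.ring k K B).toEquiv
  obtain ⟨g, hg⟩ := hinv.exists_smul_of_under_eq v.ring B (B ≃ₐ[v.ring] B) P.asIdeal P'.asIdeal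
    ((hunder P).trans (hunder P').symm)
  let σ := (galRestrict v.ring k K B).symm g
  have hσ : ∀ b : B, algebraMap B K (g b) = σ (algebraMap B K b) := by
    intro b
    rw [← algebraMap_galRestrict_apply v.ring, MulEquiv.apply_symm_apply]
  refine ⟨σ, ?_⟩
  obtain ⟨P'', hP''⟩ := exists_placeOfPrime_eq (σ • w) (hBw _ (under_smul σ w))
  rw [← hP', ← hP'']
  congr 1
  apply HeightOneSpectrum.ext
  ext b
  rw [hg, ← mem_nonunits_placeOfPrime_iff (K := K), hP'',
    Ideal.mem_pointwise_smul_iff_inv_smul_mem, ← mem_nonunits_placeOfPrime_iff (K := K), hP]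
  have hb : algebraMap B K b = σ (algebraMap B K (g⁻¹ • b)) := by
    rw [← hσ]
    exact congrArg _ (g.apply_symm_apply b).symm
  rw [hb, mem_nonunits_smul]

theorem ramificationIndex_eq (w : FinitePlace K) :
    ramificationIndex K (w.under k) = ramificationIndexAt k w := by
  have h : ∃ w' : FinitePlace K, LiesOver (Sum.inl w') (Sum.inl (w.under k)) :=
    ⟨w, (liesOver_iff _ _).2 rfl⟩
  rw [ramificationIndex, dif_pos h]
  obtain ⟨σ, hσ⟩ := exists_smul_eq_of_under_eq ((liesOver_iff _ _).1 h.choose_spec)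
  rw [← ramificationIndexAt_smul σ, hσ]

theorem ramificationIndex_pos (v : FinitePlace k) : 0 < ramificationIndex K v := by
  obtain ⟨w, rfl⟩ := exists_under_eq (K := K) v
  rw [ramificationIndex_eq]
  exact ramificationIndexAt_pos k w

theorem finite_setOf_under_eq (v : FinitePlace k) : {w : FinitePlace K | w.under k = v}.Finite := by
  obtain ⟨w, rfl⟩ := exists_under_eq (K := K) v
  refine (Set.finite_range fun σ : K ≃ₐ[k] K => σ • w).subset fun w' hw' => ?_
  exact exists_smul_eq_of_under_eq (Eq.symm hw')

end FinitePlace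

end Extension
end RayClass

namespace RayClass

open NumberField

section Extension

variable {k K : Type*} [Field k] [Field K] [Algebra k K]

theorem placesOver_nonempty [FiniteDimensional k K] [IsGalois k K] {S : Set (Place k)}
    (hS : S.Nonempty) : (placesOver K S).Nonempty := by
  obtain ⟨v | v, hv⟩ := hS
  · obtain ⟨w, rfl⟩ := FinitePlace.exists_under_eq (K := K) v
    exact ⟨Sum.inl w, (w.inl_mem_placesOver).2 hv⟩
  · obtain ⟨w, rfl⟩ := InfinitePlace.comap_surjective (K := K) v
    exact ⟨Sum.inr w, _, hv, rfl⟩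

theorem placesOver_finite [FiniteDimensional k K] [IsGalois k K] {S : Set (Place k)}
    (hS : S.Finite) [Finite (InfinitePlace K)] : (placesOver K S).Finite := by
  have h : (⋃ v ∈ {v : FinitePlace k | Sum.inl v ∈ S},
      {w : FinitePlace K | w.under k = v}).Finite :=
    (hS.preimage Sum.inl_injective.injOn).biUnion fun v _ => FinitePlace.finite_setOf_under_eq v
  refine ((h.image Sum.inl).union (Set.finite_range Sum.inr)).subset ?_
  rintro (w | w) hw
  · rw [FinitePlace.inl_mem_placesOver] at hw
    exact Or.inl ⟨w, Set.mem_biUnion hw rfl, rfl⟩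
  · exact Or.inr ⟨w, rfl⟩

namespace SModulus

variable {S : Set (Place k)} (m : SModulus S)

section Algebraic

variable [Algebra.IsAlgebraic k K]

theorem algebraMap_mem_nonunits_iff (w : FinitePlace K) (a : k) :
    algebraMap k K a ∈ w.ring.nonunits ↔ a ∈ (w.under k).ring.nonunits := by
  rw [ValuationSubring.mem_nonunits_iff_or, ValuationSubring.mem_nonunits_iff_or,
    FinitePlace.mem_under_ring, map_inv₀, map_eq_zero]

theorem finDvd_induced_iff (w : FinitePlace K) :
    (m.induced K).FinDvd w ↔ m.FinDvd (w.under k) := by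
  refine ⟨fun h => ⟨(w.inl_mem_placesOver).not.1 h.1, fun a ha => ?_⟩,
    fun h => ⟨(w.inl_mem_placesOver).not.2 h.1, fun a ha => ?_⟩⟩
  · rw [← algebraMap_mem_nonunits_iff]
    exact h.2 _ (Ideal.mem_map_of_mem (sIntegersMap K S) ha)
  · change a ∈ Ideal.span _ at ha
    induction ha using Submodule.span_induction with
    | mem a ha =>
      obtain ⟨b, hb, rfl⟩ := ha
      exact (algebraMap_mem_nonunits_iff w (b : k)).2 (h.2 b hb)
    | zero => rw [ValuationSubring.mem_nonunits_iff_or]; exact Or.inl rfl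
    | add a b _ _ ha hb =>
      rw [ValuationSubring.mem_nonunits_iff] at ha hb ⊢
      exact Valuation.map_add_lt _ ha hb
    | smul c a _ ha =>
      rw [ValuationSubring.mem_nonunits_iff] at ha ⊢
      have hc : w.ring.valuation (c : K) ≤ 1 :=
        (ValuationSubring.valuation_le_one_iff _ _).2 (c.2 w ((w.inl_mem_placesOver).not.2 h.1))
      rw [smul_eq_mul, Subring.coe_mul, map_mul]
      exact mul_lt_one_of_nonneg_of_lt_one_right hc zero_le ha

theorem inl_mem_support_induced_iff (w : FinitePlace K) :
    Sum.inl w ∈ (m.induced K).support ↔ Sum.inl (w.under k) ∈ m.support :=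
  m.finDvd_induced_iff w

theorem mem_localIdeal_induced_iff {w : FinitePlace K} (hw : Sum.inl w ∉ placesOver K S) (x : k) :
    algebraMap k K x ∈ (m.induced K).localIdeal w ↔ x ∈ m.localIdeal (w.under k) := by
  obtain ⟨a, ⟨b, hb, hba⟩, ha⟩ := m.exists_localIdeal_eq ((w.inl_mem_placesOver).not.1 hw)
  have ha0 : algebraMap k K a ≠ 0 := (map_ne_zero _).2 a.ne_zero
  rw [ha, FinitePlace.mem_under_ring, map_div₀]
  constructor
  · have hfin : ∀ c ∈ (m.induced K).fin, (c : K) / algebraMap k K a ∈ w.ring := by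
      intro c hc
      change c ∈ Ideal.span _ at hc
      induction hc using Submodule.span_induction with
      | mem c hc =>
        obtain ⟨d, hd, rfl⟩ := hc
        have h1 := (ha d).1 (Submodule.subset_span ⟨d, hd, rfl⟩)
        rw [FinitePlace.mem_under_ring, map_div₀] at h1
        exact h1
      | zero => rw [ZeroMemClass.coe_zero, zero_div]; exact zero_mem _
      | add c d _ _ hc hd => rw [Subring.coe_add, add_div]; exact add_mem hc hd
      | smul c d _ hd =>
        rw [smul_eq_mul, Subring.coe_mul, mul_div_assoc]
        exact mul_mem (c.2 w hw) hd
    intro hx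
    generalize algebraMap k K x = y at hx
    induction hx using Submodule.span_induction with
    | mem y hy =>
      obtain ⟨c, hc, rfl⟩ := hy
      exact hfin c hc
    | zero => rw [zero_div]; exact zero_mem _
    | add y z _ _ hy hz => rw [add_div]; exact add_mem hy hz
    | smul c y _ hy =>
      rw [show c • y = (c : K) * y from rfl, mul_div_assoc]
      exact mul_mem c.2 hy
  · intro h
    have h1 := Submodule.smul_mem ((m.induced K).localIdeal w)
      (⟨algebraMap k K x / algebraMap k K a, h⟩ : w.ring)
      (Submodule.subset_span ⟨_, Ideal.mem_map_of_mem (sIntegersMap K S) hb, rfl⟩)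
    rw [show ((sIntegersMap K S b : sIntegers (placesOver K S)) : K) = algebraMap k K b from rfl,
      hba, show ∀ (c : w.ring) (y : K), c • y = (c : K) * y from fun _ _ => rfl,
      div_mul_cancel₀ _ ha0] at h1
    exact h1

end Algebraic

theorem map_mem_rayGroup_iff [FiniteDimensional k K] [IsGalois k K] (x : kˣ) :
    Units.map (algebraMap k K : k →* K) x ∈ (m.induced K).rayGroup ↔
      x ∈ (m.unramifiedPart K).rayGroup := by
  have hval : ((Units.map (algebraMap k K : k →* K) x : Kˣ) : K) = algebraMap k K x := rfl
  refine and_congr ⟨fun h v hv => ?_, fun h w hw => ?_⟩ ⟨fun h v hv => ?_, fun h w hw => ?_⟩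
  · obtain ⟨w, rfl⟩ := FinitePlace.exists_under_eq (K := K) v
    have h1 := h w ((m.finDvd_induced_iff w).2 hv)
    rw [hval, ← map_one (algebraMap k K), ← map_sub,
      m.mem_localIdeal_induced_iff ((m.finDvd_induced_iff w).2 hv).1] at h1
    exact h1
  · rw [hval, ← map_one (algebraMap k K), ← map_sub, m.mem_localIdeal_induced_iff hw.1]
    exact h _ ((m.finDvd_induced_iff w).1 hw)
  · obtain ⟨w, rfl⟩ := InfinitePlace.comap_surjective (K := K) v
    have hr : w.IsReal := by
      have h1 := InfinitePlace.isUnramified_iff.1 (InfinitePlace.isUnramifiedIn_comap.1 hv.2)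
      exact h1.resolve_right (InfinitePlace.not_isComplex_iff_isReal.2 (m.isReal _ hv.1))
    have h1 := h w ⟨hr, hv.1⟩
    convert h1 using 1
    apply Complex.ofReal_injective
    rw [InfinitePlace.embedding_of_isReal_apply, InfinitePlace.embedding_of_isReal_apply,
      InfinitePlace.comap_embedding_of_isReal _ (m.isReal _ hv.1)]
    rfl
  · have hv : w.comap (algebraMap k K) ∈ (m.unramifiedPart K).inf :=
      ⟨hw.2, InfinitePlace.isUnramifiedIn_comap.2 (InfinitePlace.isUnramified_iff.2 (Or.inl hw.1))⟩
    have h1 := h _ hv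
    convert h1 using 1
    apply Complex.ofReal_injective
    rw [InfinitePlace.embedding_of_isReal_apply, InfinitePlace.embedding_of_isReal_apply,
      InfinitePlace.comap_embedding_of_isReal _ (m.isReal _ hw.2)]
    rfl

end SModulus

end Extension
end RayClass

section GroupCohomologyFinite

open CategoryTheory groupCohomology

variable {G : Type} [Group G]

theorem card_smul_H1_eq_zero [Fintype G] (A : Rep ℤ G) (x : H1 A) : Fintype.card G • x = 0 := by
  induction x using H1_induction_on with
  | h f =>
    rw [← map_nsmul (H1π A).hom]
    refine (H1π_eq_zero_iff _).2 ?_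
    have hf := (mem_cocycles₁_iff (f : G → A)).1 f.2
    refine ⟨-∑ h, f h, funext fun g => ?_⟩
    have h1 : ∑ h, f (g * h) = ∑ h, f h := Equiv.sum_comp (Equiv.mulLeft g) (fun h => f h)
    have h2 : ∑ h, f (g * h) = A.ρ g (∑ h, f h) + Fintype.card G • f g := by
      rw [Finset.sum_congr rfl fun h _ => hf g h, Finset.sum_add_distrib, map_sum (A.ρ g)]
      simp
    rw [h1] at h2
    change A.ρ g (-∑ h, f h) - (-∑ h, f h) = Fintype.card G • f g
    rw [map_neg, sub_neg_eq_add, neg_add_eq_sub, sub_eq_iff_eq_add']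
    exact h2

theorem card_smul_H2_eq_zero [Fintype G] (A : Rep ℤ G) (x : H2 A) : Fintype.card G • x = 0 := by
  induction x using H2_induction_on with
  | h f =>
    rw [← map_nsmul (H2π A).hom]
    refine (H2π_eq_zero_iff _).2 ?_
    have hf := (mem_cocycles₂_iff (f : G × G → A)).1 f.2
    refine ⟨fun g => ∑ j, f (g, j), funext fun gh => ?_⟩
    obtain ⟨g, h⟩ := gh
    have h1 : ∑ j, f (g, h * j) = ∑ j, f (g, j) :=
      Equiv.sum_comp (Equiv.mulLeft h) (fun j => f (g, j))
    have h2 : ∑ j, (f (g * h, j) + f (g, h)) = ∑ j, (A.ρ g (f (h, j)) + f (g, h * j)) :=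
      Finset.sum_congr rfl fun j _ => hf g h j
    rw [Finset.sum_add_distrib, Finset.sum_add_distrib, h1, ← map_sum (A.ρ g)] at h2
    change A.ρ g (∑ j, f (h, j)) - ∑ j, f (g * h, j) + ∑ j, f (g, j) =
      Fintype.card G • f (g, h)
    have h3 : ∑ _j : G, f (g, h) = Fintype.card G • f (g, h) := by simp
    rw [h3] at h2
    rw [sub_add_eq_add_sub, ← h2, add_sub_cancel_left]

theorem finite_of_surjective_of_smul_eq_zero {M N : Type*} [AddCommGroup M] [AddCommGroup N]
    [Module.Finite ℤ M] (f : M →+ N) (hf : Function.Surjective f) {n : ℕ} (hn : n ≠ 0)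
    (h : ∀ x : N, n • x = 0) : Finite N := by
  have : Module.Finite ℤ N := Module.Finite.of_surjective f.toIntLinearMap hf
  exact Module.finite_of_fg_torsion N fun x =>
    ⟨⟨n, mem_nonZeroDivisors_of_ne_zero (Nat.cast_ne_zero.2 hn)⟩,
      (natCast_zsmul x n).trans (h x)⟩

theorem finite_of_injective_of_fg {M N : Type*} [AddCommGroup M] [AddCommGroup N]
    [Module.Finite ℤ M] (f : N →+ M) (hf : Function.Injective f) : Module.Finite ℤ N :=
  Module.Finite.of_injective f.toIntLinearMap hf

theorem finite_H1_of_fg [Finite G] (A : Rep ℤ G) (hA : AddGroup.FG A) : Finite (H1 A) := by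
  have := Fintype.ofFinite G
  have : Module.Finite ℤ A := Module.Finite.iff_addGroup_fg.2 hA
  have : Module.Finite ℤ (cocycles₁ A) :=
    finite_of_injective_of_fg (cocycles₁ A).subtype.toAddMonoidHom Subtype.val_injective
  exact finite_of_surjective_of_smul_eq_zero (H1π A).hom.toAddMonoidHom
    ((ModuleCat.epi_iff_surjective _).1 inferInstance) Fintype.card_ne_zero
    (card_smul_H1_eq_zero A)

theorem finite_H2_of_fg [Finite G] (A : Rep ℤ G) (hA : AddGroup.FG A) : Finite (H2 A) := by
  have := Fintype.ofFinite G
  have : Module.Finite ℤ A := Module.Finite.iff_addGroup_fg.2 hA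
  have : Module.Finite ℤ (cocycles₂ A) :=
    finite_of_injective_of_fg (cocycles₂ A).subtype.toAddMonoidHom Subtype.val_injective
  exact finite_of_surjective_of_smul_eq_zero (H2π A).hom.toAddMonoidHom
    ((ModuleCat.epi_iff_surjective _).1 inferInstance) Fintype.card_ne_zero
    (card_smul_H2_eq_zero A)

end GroupCohomologyFinite

section LongExactSequence

open CategoryTheory groupCohomology

variable {R G : Type} [CommRing R] [Group G]

theorem Rep.shortExact_of_exact {X : ShortComplex (Rep R G)}
    (hf : Function.Injective X.f.hom) (hg : Function.Surjective X.g.hom)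
    (h : ∀ y, X.g.hom y = 0 → ∃ x, X.f.hom x = y) : X.ShortExact where
  exact := by
    rw [← ShortComplex.exact_map_iff_of_faithful _ (forget₂ (Rep R G) (ModuleCat R)),
      ShortComplex.moduleCat_exact_iff]
    exact h
  mono_f := (Rep.mono_iff_injective _).2 hf
  epi_g := (Rep.epi_iff_surjective _).2 hg

variable {X : ShortComplex (Rep R G)} (hX : X.ShortExact)

include hX

theorem range_H1_map_eq_ker :
    LinearMap.range (map (MonoidHom.id G) X.f 1).hom =
      LinearMap.ker (map (MonoidHom.id G) X.g 1).hom :=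
  (mapShortComplex₂_exact hX 1).moduleCat_range_eq_ker

theorem range_H1_map_eq_ker_δ :
    LinearMap.range (map (MonoidHom.id G) X.g 1).hom = LinearMap.ker (δ hX 1 2 rfl).hom :=
  (mapShortComplex₃_exact hX (rfl : 1 + 1 = 2)).moduleCat_range_eq_ker

theorem range_δ_eq_ker_H2_map :
    LinearMap.range (δ hX 1 2 rfl).hom = LinearMap.ker (map (MonoidHom.id G) X.f 2).hom :=
  (mapShortComplex₁_exact hX (rfl : 1 + 1 = 2)).moduleCat_range_eq_ker

theorem exists_connecting_invariants :
    ∃ φ : X.X₃.ρ.invariants →ₗ[R] H1 X.X₁,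
      (∀ y, φ y = 0 ↔ ∃ x ∈ X.X₂.ρ.invariants, X.g.hom x = y) ∧
      LinearMap.range φ = LinearMap.ker (map (MonoidHom.id G) X.f 1).hom := by
  have h1 : LinearMap.range (δ hX 0 1 rfl).hom =
      LinearMap.ker (map (MonoidHom.id G) X.f 1).hom :=
    (mapShortComplex₁_exact hX (rfl : 0 + 1 = 1)).moduleCat_range_eq_ker
  have h0 : LinearMap.range (map (MonoidHom.id G) X.g 0).hom =
      LinearMap.ker (δ hX 0 1 rfl).hom :=
    (mapShortComplex₃_exact hX (rfl : 0 + 1 = 1)).moduleCat_range_eq_ker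
  refine ⟨(δ hX 0 1 rfl).hom ∘ₗ (H0Iso X.X₃).inv.hom, fun y => ?_, ?_⟩
  · rw [LinearMap.comp_apply, ← LinearMap.mem_ker, ← h0]
    constructor
    · rintro ⟨z, hz⟩
      refine ⟨(H0Iso X.X₂).hom z, Subtype.prop _, ?_⟩
      have h := ConcreteCategory.congr_hom (map_id_comp_H0Iso_hom X.g) z
      rw [ConcreteCategory.comp_apply, ConcreteCategory.comp_apply] at h
      rw [show map (MonoidHom.id G) X.g 0 z = (H0Iso X.X₃).inv y from hz] at h
      rw [Iso.inv_hom_id_apply] at h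
      exact congrArg Subtype.val h.symm
    · rintro ⟨x, hx, hxy⟩
      refine ⟨(H0Iso X.X₂).inv ⟨x, hx⟩, ?_⟩
      have h := ConcreteCategory.congr_hom (map_id_comp_H0Iso_hom X.g) ((H0Iso X.X₂).inv ⟨x, hx⟩)
      rw [ConcreteCategory.comp_apply, ConcreteCategory.comp_apply, Iso.inv_hom_id_apply] at h
      have h' := congrArg (H0Iso X.X₃).inv h
      rw [Iso.hom_inv_id_apply] at h'
      refine h'.trans (congrArg (H0Iso X.X₃).inv (Subtype.ext hxy))
  · rw [LinearMap.range_comp_of_range_eq_top _ (LinearMap.range_eq_top.2 ?_), h1]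
    exact (ModuleCat.epi_iff_surjective _).1 inferInstance

end LongExactSequence

theorem finite_of_surjective_of_fg_quotient {A N : Type*} [AddCommGroup A] [AddCommGroup N]
    (X : AddSubgroup A) (L : Submodule ℤ A) [Module.Finite ℤ (A ⧸ L)] (f : X →+ N)
    (hf : Function.Surjective f) (hL : ∀ x : X, (x : A) ∈ L → f x = 0) {n : ℕ} (hn : n ≠ 0)
    (h : ∀ x : N, n • x = 0) : Finite N := by
  let φ : X →+ A ⧸ L := L.mkQ.toAddMonoidHom.comp X.subtype
  have : Module.Finite ℤ (X ⧸ φ.ker) :=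
    finite_of_injective_of_fg (QuotientAddGroup.kerLift φ) (QuotientAddGroup.kerLift_injective φ)
  refine finite_of_surjective_of_smul_eq_zero (QuotientAddGroup.lift φ.ker f fun x hx => ?_)
    (QuotientAddGroup.lift_surjective_of_surjective _ f hf _) hn h
  exact hL x ((Submodule.Quotient.mk_eq_zero L).1 hx)

namespace RayClass

namespace SModulus

open CategoryTheory groupCohomology

variable {k K : Type} [Field k] [Field K] [Algebra k K] {S : Set (Place k)} (m : SModulus S)

theorem smul_divisor_apply (σ : K ≃ₐ[k] K) (D : (m.induced K).divisorGroup) (w : FinitePlace K) :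
    (σ • D).1 w = D.1 (σ⁻¹ • w) := by
  have h : (σ • D).1 (σ • (σ⁻¹ • w)) = D.1 (σ⁻¹ • w) :=
    Finsupp.mapDomain_apply (MulAction.injective σ) D.1 (σ⁻¹ • w)
  rwa [smul_inv_smul] at h

variable (K) in
/-- The `Gal(K/k)`-module `I_K^{S(𝔪) ∪ S}`. -/
abbrev divisorRep : Rep ℤ (K ≃ₐ[k] K) :=
  Rep.ofDistribMulAction ℤ (K ≃ₐ[k] K) (m.induced K).divisorGroup

variable (K) in
/-- The `Gal(K/k)`-module `Cl^𝔪_{K,S}`. -/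
abbrev classRep : Rep ℤ (K ≃ₐ[k] K) :=
  Rep.ofDistribMulAction ℤ (K ≃ₐ[k] K) (m.induced K).ClassGroup

/-- The principal divisors as a `Gal(K/k)`-module. -/
instance principalDivisorsAction :
    DistribMulAction (K ≃ₐ[k] K) (m.induced K).principalDivisors where
  smul σ D := ⟨σ • D.1, m.smul_mem_principalDivisors σ D.2⟩
  one_smul D := Subtype.ext (one_smul _ D.1)
  mul_smul σ τ D := Subtype.ext (mul_smul σ τ D.1)
  smul_zero σ := Subtype.ext (smul_zero σ)
  smul_add σ D E := Subtype.ext (smul_add σ D.1 E.1)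

variable (K) in
/-- The `Gal(K/k)`-module of principal divisors. -/
abbrev principalRep : Rep ℤ (K ≃ₐ[k] K) :=
  Rep.ofDistribMulAction ℤ (K ≃ₐ[k] K) (m.induced K).principalDivisors

section Finite

variable [FiniteDimensional k K]

theorem subsingleton_H1_divisorRep : Subsingleton (H1 (m.divisorRep K)) := by
  have := Fintype.ofFinite (K ≃ₐ[k] K)
  refine subsingleton_of_forall_eq 0 fun x => ?_
  induction x using H1_induction_on with
  | h f =>
    have h := card_smul_H1_eq_zero _ (H1π (m.divisorRep K) f)
    rw [← map_nsmul (H1π (m.divisorRep K)).hom] at h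
    obtain ⟨D, hD⟩ := (H1π_eq_zero_iff _).1 h
    set n := Fintype.card (K ≃ₐ[k] K)
    have hn : (n : ℤ) ≠ 0 := Nat.cast_ne_zero.2 Fintype.card_ne_zero
    let D₁ : (m.induced K).divisorGroup := D
    have hD' : ∀ (σ : K ≃ₐ[k] K) (w : FinitePlace K),
        D₁.1 (σ⁻¹ • w) = D₁.1 w + n * (f σ : (m.induced K).divisorGroup).1 w := by
      intro σ w
      have h1 : σ • D₁ - D₁ = n • (f σ : (m.induced K).divisorGroup) := congrFun hD σ
      have h2 : (σ • D₁).1 w - D₁.1 w = n • (f σ : (m.induced K).divisorGroup).1 w :=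
        congrArg (fun E : (m.induced K).divisorGroup => E.1 w) h1
      rw [smul_divisor_apply, nsmul_eq_mul] at h2
      exact sub_eq_iff_eq_add'.1 h2
    refine (H1π_eq_zero_iff _).2 ⟨(⟨D₁.1.mapRange (· / (n : ℤ)) (Int.zero_ediv _), ?_⟩ :
      (m.induced K).divisorGroup), ?_⟩
    · intro w hw
      rw [Finsupp.mapRange_apply, D₁.2 w hw, Int.zero_ediv]
    · funext σ
      refine Subtype.ext (Finsupp.ext fun w => ?_)
      refine (congrArg (· - D₁.1 w / (n : ℤ)) (m.smul_divisor_apply σ _ w)).trans ?_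
      change D₁.1 (σ⁻¹ • w) / (n : ℤ) - D₁.1 w / (n : ℤ) = _
      rw [hD', Int.add_mul_ediv_left _ _ hn, add_sub_cancel_left]

theorem finite_H1_rayRep (hK : IsGlobalField K) (hS : (placesOver K S).Nonempty) :
    Finite (H1 (m.rayRep K)) := by
  have := Fintype.ofFinite (K ≃ₐ[k] K)
  have := (m.induced K).finite_quotient_rayGroup hK hS
  let X : AddSubgroup (Additive Kˣ) :=
    { carrier := {x | ∀ σ : K ≃ₐ[k] K, σ • x.toMul / x.toMul ∈ (m.induced K).rayGroup}
      add_mem' := by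
        intro x y hx hy σ
        rw [toMul_add, smul_mul', mul_div_mul_comm]
        exact mul_mem (hx σ) (hy σ)
      zero_mem' := by
        intro σ
        rw [toMul_zero, smul_one, div_one]
        exact one_mem _
      neg_mem' := by
        intro x hx σ
        rw [toMul_neg, smul_inv', ← inv_div_inv, inv_inv, inv_inv, ← inv_div]
        exact inv_mem (hx σ) }
  let c : X → (K ≃ₐ[k] K) → m.rayRep K := fun x σ => show Additive (m.induced K).rayGroup from
    Additive.ofMul ⟨σ • x.1.toMul / x.1.toMul, x.2 σ⟩
  have hmem : ∀ x : X, c x ∈ cocycles₁ (m.rayRep K) := by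
    intro x
    refine (mem_cocycles₁_iff _).2 fun σ τ => ?_
    refine Additive.toMul.injective (Subtype.ext ?_)
    change (σ * τ) • x.1.toMul / x.1.toMul =
      σ • (τ • x.1.toMul / x.1.toMul) * (σ • x.1.toMul / x.1.toMul)
    rw [smul_div', mul_smul, div_mul_div_cancel]
  let F : X →+ cocycles₁ (m.rayRep K) :=
    { toFun x := ⟨_, hmem x⟩
      map_zero' := Subtype.ext (funext fun σ => Additive.toMul.injective (Subtype.ext (by
        change σ • (1 : Kˣ) / 1 = 1
        rw [smul_one, div_one])))
      map_add' x y := Subtype.ext (funext fun σ => Additive.toMul.injective (Subtype.ext (by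
        change σ • (x.1.toMul * y.1.toMul) / (x.1.toMul * y.1.toMul) =
          (σ • x.1.toMul / x.1.toMul) * (σ • y.1.toMul / y.1.toMul)
        rw [smul_mul', mul_div_mul_comm]))) }
  refine finite_of_surjective_of_fg_quotient X
    (Subgroup.toAddSubgroup (m.induced K).rayGroup).toIntSubmodule
    ((H1π (m.rayRep K)).hom.toAddMonoidHom.comp F) ?_ ?_ Fintype.card_ne_zero
    (card_smul_H1_eq_zero (m.rayRep K))
  · intro c
    induction c using H1_induction_on with
    | h f =>
      have hf := (mem_cocycles₁_iff (f : (K ≃ₐ[k] K) → m.rayRep K)).1 f.2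
      let f₁ : (K ≃ₐ[k] K) → (m.induced K).rayGroup := fun σ => Additive.toMul (f σ)
      obtain ⟨x, hx⟩ := isMulCoboundary₁_of_isMulCocycle₁_of_aut_to_units
        (fun σ => (f₁ σ : Kˣ)) fun σ τ => by
          have : f₁ (σ * τ) = σ • f₁ τ * f₁ σ := congrArg Additive.toMul (hf σ τ)
          exact congrArg Subtype.val this
      refine ⟨⟨Additive.ofMul x, fun σ => ?_⟩, ?_⟩
      · have := hx σ
        rw [toMul_ofMul, this]
        exact (f₁ σ).2
      · refine congrArg (H1π (m.rayRep K)) (Subtype.ext (funext fun σ => ?_))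
        exact Additive.toMul.injective (Subtype.ext (hx σ))
  · intro x hx
    refine (H1π_eq_zero_iff _).2 ⟨show Additive (m.induced K).rayGroup from
      Additive.ofMul ⟨x.1.toMul, hx⟩, funext fun σ => ?_⟩
    exact Additive.toMul.injective (Subtype.ext rfl)

end Finite

theorem fg_unitRep (hK : IsGlobalField K) (hS : (placesOver K S).Finite) :
    AddGroup.FG (m.unitRep K) := by
  have := (m.induced K).finite_unitGroup hK hS
  exact Module.Finite.iff_addGroup_fg.1 this

end SModulus

end RayClass

namespace RayClass

namespace SModulus

open CategoryTheory groupCohomology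

section Divisor

variable {F : Type*} [Field F] {S : Set (Place F)} (m : SModulus S) (hF : IsGlobalField F)

open Classical in
/-- The divisor `∑_{w ∉ S} ord_w(x) w` of an element `x` of `F^𝔪`, as a principal divisor. -/
def divHom : Additive m.rayGroup →+ m.principalDivisors where
  toFun x := ⟨⟨Finsupp.ofSupportFinite
      (fun w => if Sum.inl w ∈ S then 0 else w.ord x.toMul.1)
      ((hF.finite_setOf_ord_ne_zero x.toMul.1).subset fun w hw => by
        by_contra h
        rw [Set.mem_ofPred_eq, not_not] at h
        exact hw (by simp [h])),
      fun w hw => by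
        change (if Sum.inl w ∈ S then 0 else w.ord x.toMul.1) = 0
        split_ifs with h
        · rfl
        · exact m.ord_eq_zero_of_mem_rayGroup x.toMul.2 (hw.resolve_left h)⟩,
    x.toMul.1, x.toMul.2, fun w hw => if_neg hw⟩
  map_zero' := Subtype.ext (Subtype.ext (Finsupp.ext fun w => by
    change (if Sum.inl w ∈ S then 0 else w.ord 1) = 0
    split_ifs
    · rfl
    · exact w.ord_one))
  map_add' x y := Subtype.ext (Subtype.ext (Finsupp.ext fun w => by
    change (if Sum.inl w ∈ S then 0 else w.ord (x.toMul.1 * y.toMul.1)) =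
      (if Sum.inl w ∈ S then 0 else w.ord x.toMul.1) +
        (if Sum.inl w ∈ S then 0 else w.ord y.toMul.1)
    split_ifs
    · rfl
    · exact w.ord_mul _ _))

theorem divHom_apply_of_notMem (x : Additive m.rayGroup) {w : FinitePlace F}
    (hw : Sum.inl w ∉ S) : (m.divHom hF x).1.1 w = w.ord x.toMul.1 := if_neg hw

theorem divHom_eq_iff (x : Additive m.rayGroup) (D : m.principalDivisors) :
    m.divHom hF x = D ↔ ∀ w : FinitePlace F, Sum.inl w ∉ S → D.1.1 w = w.ord x.toMul.1 := by
  constructor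
  · rintro rfl w hw
    exact m.divHom_apply_of_notMem hF x hw
  · intro h
    refine Subtype.ext (Subtype.ext (Finsupp.ext fun w => ?_))
    by_cases hw : Sum.inl w ∈ S
    · rw [(m.divHom hF x).1.2 w (Or.inl hw), D.1.2 w (Or.inl hw)]
    · rw [m.divHom_apply_of_notMem hF x hw, h w hw]

theorem divHom_surjective : Function.Surjective (m.divHom hF) := by
  rintro ⟨D, x, hx, h⟩
  exact ⟨Additive.ofMul ⟨x, hx⟩, (m.divHom_eq_iff hF _ _).2 h⟩

theorem mem_unitGroup_iff {x : Fˣ} : x ∈ m.unitGroup ↔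
    x ∈ m.rayGroup ∧ ∀ w : FinitePlace F, Sum.inl w ∉ S → w.ord x = 0 := by
  rw [and_comm]
  refine and_congr_left fun _ => ⟨fun h w hw => le_antisymm ?_ ?_, fun h => ⟨?_, ?_⟩⟩
  · have := (w.mem_ring_iff x⁻¹).1 (h.2 w hw)
    rw [w.ord_inv] at this
    linarith
  · exact (w.mem_ring_iff x).1 (h.1 w hw)
  · exact fun w hw => (w.mem_ring_iff x).2 (h w hw).ge
  · exact fun w hw => (w.mem_ring_iff x⁻¹).2 (by rw [w.ord_inv, h w hw, neg_zero])

theorem divHom_eq_zero_iff (x : Additive m.rayGroup) :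
    m.divHom hF x = 0 ↔ x.toMul.1 ∈ m.unitGroup := by
  rw [divHom_eq_iff, mem_unitGroup_iff]
  exact ⟨fun h => ⟨x.toMul.2, fun w hw => (h w hw).symm⟩, fun h w hw => (h.2 w hw).symm⟩

end Divisor

section Sequences

variable {k K : Type} [Field k] [Field K] [Algebra k K] {S : Set (Place k)} (m : SModulus S)
  (hK : IsGlobalField K)

theorem divHom_smul (σ : K ≃ₐ[k] K) (x : (m.induced K).rayGroup) :
    (m.induced K).divHom hK (Additive.ofMul (σ • x)) =
      σ • (m.induced K).divHom hK (Additive.ofMul x) := by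
  rw [divHom_eq_iff]
  intro w hw
  refine (m.smul_divisor_apply σ _ w).trans ?_
  rw [divHom_apply_of_notMem _ _ _ (by rwa [smul_mem_placesOver])]
  have := ord_smul σ (σ⁻¹ • w) x.1
  rw [smul_inv_smul] at this
  exact this.symm

/-- The divisor map `K^𝔪 → P_K^{𝔪,S}` of `Gal(K/k)`-modules. -/
def divRepHom : m.rayRep K ⟶ m.principalRep K :=
  Rep.ofHom
    { toLinearMap := ((m.induced K).divHom hK).toIntLinearMap
      isIntertwining' := fun σ => LinearMap.ext fun x => m.divHom_smul hK σ (Additive.toMul x) }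

theorem unitInclusion_comp_divRepHom : m.unitInclusion K ≫ m.divRepHom hK = 0 := by
  ext x
  exact ((m.induced K).divHom_eq_zero_iff hK _).2 (Additive.toMul x).2

/-- The sequence `0 → E^𝔪_{K,S} → K^𝔪 → P_K^{𝔪,S} → 0` is exact. -/
theorem unitSequence_shortExact :
    (ShortComplex.mk _ _ (m.unitInclusion_comp_divRepHom hK)).ShortExact := by
  refine Rep.shortExact_of_exact ?_ ((m.induced K).divHom_surjective hK) ?_
  · intro x y h
    exact Subtype.ext (congrArg (fun z : (m.induced K).rayGroup => z.1) h)
  · intro y hy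
    exact ⟨show Additive (m.induced K).unitGroup from
      Additive.ofMul ⟨_, ((m.induced K).divHom_eq_zero_iff hK y).1 hy⟩, rfl⟩

variable (K) in
/-- The inclusion `P_K^{𝔪,S} → I_K^{S(𝔪) ∪ S}` of `Gal(K/k)`-modules. -/
def principalInclusion : m.principalRep K ⟶ m.divisorRep K :=
  Rep.ofHom
    { toLinearMap := (m.induced K).principalDivisors.subtype.toIntLinearMap
      isIntertwining' := fun _ => rfl }

variable (K) in
/-- The projection `I_K^{S(𝔪) ∪ S} → Cl^𝔪_{K,S}` of `Gal(K/k)`-modules. -/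
def classProjection : m.divisorRep K ⟶ m.classRep K :=
  Rep.ofHom
    { toLinearMap := (QuotientAddGroup.mk' (m.induced K).principalDivisors).toIntLinearMap
      isIntertwining' := fun _ => rfl }

variable (K) in
theorem principalInclusion_comp_classProjection :
    m.principalInclusion K ≫ m.classProjection K = 0 := by
  ext x
  exact (QuotientAddGroup.eq_zero_iff _).2 x.2

variable (K) in
/-- The sequence `0 → P_K^{𝔪,S} → I_K^{S(𝔪) ∪ S} → Cl^𝔪_{K,S} → 0` is exact. -/
theorem classSequence_shortExact :
    (ShortComplex.mk _ _ (m.principalInclusion_comp_classProjection K)).ShortExact := by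
  refine Rep.shortExact_of_exact Subtype.val_injective QuotientAddGroup.mk_surjective ?_
  intro y hy
  exact ⟨⟨y, (QuotientAddGroup.eq_zero_iff _).1 hy⟩, rfl⟩

end Sequences

end SModulus

end RayClass

theorem LinearMap.card_eq_card_ker_mul_card_range {R M N : Type*} [Ring R] [AddCommGroup M]
    [AddCommGroup N] [Module R M] [Module R N] (f : M →ₗ[R] N) :
    Nat.card M = Nat.card (LinearMap.ker f) * Nat.card (LinearMap.range f) := by
  rw [Submodule.card_eq_card_quotient_mul_card (LinearMap.ker f),
    Nat.card_congr f.quotKerEquivRange.toEquiv, mul_comm]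

section Counting

open CategoryTheory groupCohomology

variable {R G : Type} [CommRing R] [Group G]

/-- The map on invariants induced by a morphism of representations. -/
def Rep.mapInvariants {A B : Rep R G} (f : A ⟶ B) : A.ρ.invariants →ₗ[R] B.ρ.invariants :=
  f.hom.toLinearMap.restrict fun x hx g => by
    have h := Rep.hom_comm_apply f g x
    rw [hx g] at h
    exact h.symm

variable {A B P I C : Rep R G} {f : A ⟶ B} {g : B ⟶ P} {i : P ⟶ I} {q : I ⟶ C}
  {hfg : f ≫ g = 0} {hiq : i ≫ q = 0}

theorem index_range_invariants (hX : (ShortComplex.mk f g hfg).ShortExact)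
    (hY : (ShortComplex.mk i q hiq).ShortExact) :
    (LinearMap.range (Rep.mapInvariants (g ≫ i))).toAddSubgroup.index =
      Nat.card (LinearMap.ker (map (MonoidHom.id G) f 1).hom) *
        Nat.card (LinearMap.range (Rep.mapInvariants q)) := by
  obtain ⟨φ, hφ, hφr⟩ := exists_connecting_invariants hX
  have hi : Function.Injective i.hom := (Rep.mono_iff_injective _).1 hY.mono_f
  have hinj : Function.Injective (Rep.mapInvariants i) := fun x y h =>
    Subtype.ext (hi (congrArg Subtype.val h))
  have hker : LinearMap.ker (Rep.mapInvariants q) = LinearMap.range (Rep.mapInvariants i) := by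
    ext y
    constructor
    · intro hy
      have hex := hY.exact.map (forget₂ (Rep R G) (ModuleCat R))
      obtain ⟨x, hx⟩ := (ShortComplex.moduleCat_exact_iff _).1 hex y.1 (congrArg Subtype.val hy)
      have hx' : i.hom x = y.1 := hx
      refine ⟨⟨x, fun s => hi ?_⟩, Subtype.ext hx'⟩
      have := Rep.hom_comm_apply i s x
      rw [hx'] at this ⊢
      exact this.trans (y.2 s)
    · rintro ⟨x, rfl⟩
      exact Subtype.ext (congrArg (fun h : P ⟶ C => h.hom x.1) hiq)
  have hφk : LinearMap.ker φ = LinearMap.range (Rep.mapInvariants g) := by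
    ext y
    refine (hφ y).trans ⟨?_, ?_⟩
    · rintro ⟨x, hx, h⟩
      exact ⟨⟨x, hx⟩, Subtype.ext h⟩
    · rintro ⟨x, rfl⟩
      exact ⟨x.1, x.2, rfl⟩
  have hle : (LinearMap.range (Rep.mapInvariants (g ≫ i))).toAddSubgroup ≤
      (LinearMap.ker (Rep.mapInvariants q)).toAddSubgroup := by
    rw [hker]
    rintro _ ⟨x, rfl⟩
    exact ⟨Rep.mapInvariants g x, rfl⟩
  rw [← AddSubgroup.relIndex_mul_index hle]
  congr 1
  · have h1 : (LinearMap.range (Rep.mapInvariants (g ≫ i))).toAddSubgroup =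
        (LinearMap.ker φ).toAddSubgroup.map (Rep.mapInvariants i).toAddMonoidHom := by
      rw [hφk]
      ext y
      constructor
      · rintro ⟨x, rfl⟩
        exact ⟨_, ⟨x, rfl⟩, rfl⟩
      · rintro ⟨_, ⟨x, rfl⟩, rfl⟩
        exact ⟨x, rfl⟩
    have h2 : (LinearMap.ker (Rep.mapInvariants q)).toAddSubgroup =
        (⊤ : AddSubgroup P.ρ.invariants).map (Rep.mapInvariants i).toAddMonoidHom := by
      rw [hker]
      ext y
      constructor
      · rintro ⟨x, rfl⟩
        exact ⟨x, trivial, rfl⟩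
      · rintro ⟨x, -, rfl⟩
        exact ⟨x, rfl⟩
    rw [h1, h2, AddSubgroup.relIndex_map_map_of_injective _ _ hinj, AddSubgroup.relIndex_top_right,
      ← hφr]
    exact Nat.card_congr φ.quotKerEquivRange.toEquiv
  · exact Nat.card_congr (Rep.mapInvariants q).quotKerEquivRange.toEquiv

theorem card_invariants_mul_eq [Subsingleton (H1 I)]
    (hX : (ShortComplex.mk f g hfg).ShortExact) (hY : (ShortComplex.mk i q hiq).ShortExact) :
    Nat.card C.ρ.invariants * Nat.card (H1 A) *
        Nat.card (LinearMap.range (map (MonoidHom.id G) f 2).hom) =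
      (LinearMap.range (Rep.mapInvariants (g ≫ i))).toAddSubgroup.index *
        Nat.card (H2 A) * Nat.card (H1 B) := by
  obtain ⟨φ, hφ, hφr⟩ := exists_connecting_invariants hY
  have hφk : LinearMap.ker φ = LinearMap.range (Rep.mapInvariants q) := by
    ext y
    refine (hφ y).trans ⟨?_, ?_⟩
    · rintro ⟨x, hx, h⟩
      exact ⟨⟨x, hx⟩, Subtype.ext h⟩
    · rintro ⟨x, rfl⟩
      exact ⟨x.1, x.2, rfl⟩
  have htop : LinearMap.range φ = ⊤ := by
    rw [hφr, eq_top_iff]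
    exact fun x _ => Subsingleton.elim (α := H1 I) _ _
  have hC := φ.card_eq_card_ker_mul_card_range
  rw [hφk, htop, Nat.card_congr (Submodule.topEquiv (R := R) (M := H1 P)).toEquiv,
    (δ hX 1 2 rfl).hom.card_eq_card_ker_mul_card_range, ← range_H1_map_eq_ker_δ hX,
    range_δ_eq_ker_H2_map hX] at hC
  rw [index_range_invariants hX hY, hC,
    (map (MonoidHom.id G) f 1).hom.card_eq_card_ker_mul_card_range,
    (map (MonoidHom.id G) f 2).hom.card_eq_card_ker_mul_card_range,
    (map (MonoidHom.id G) g 1).hom.card_eq_card_ker_mul_card_range,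
    ← range_H1_map_eq_ker hX]
  ring

end Counting

section FinsuppIndex

variable {U : Type*} (a : U → ℕ)

/-- The subgroup of `U →₀ ℤ` of the `n` with `a u ∣ n u` for all `u`. -/
def dvdSubgroup : AddSubgroup (U →₀ ℤ) where
  carrier := {n | ∀ u, (a u : ℤ) ∣ n u}
  add_mem' h h' u := dvd_add (h u) (h' u)
  zero_mem' _ := dvd_zero _
  neg_mem' h u := (dvd_neg (α := ℤ)).2 (h u)

theorem finite_setOf_ne_one_of_index_dvdSubgroup (h : (dvdSubgroup a).index ≠ 0) :
    {u | a u ≠ 1}.Finite := by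
  classical
  have : (dvdSubgroup a).FiniteIndex := ⟨h⟩
  have hfin : Finite ((U →₀ ℤ) ⧸ dvdSubgroup a) := inferInstance
  have hinj : Function.Injective (fun u : {u | a u ≠ 1} =>
      ((Finsupp.single u.1 (1 : ℤ) : U →₀ ℤ) : (U →₀ ℤ) ⧸ dvdSubgroup a)) := by
    intro u v huv
    by_contra hne
    have hmem := QuotientAddGroup.eq.1 huv v.1
    rw [Finsupp.add_apply, Finsupp.neg_apply, Finsupp.single_eq_same,
      Finsupp.single_eq_of_ne (fun h => hne (Subtype.ext h.symm)), neg_zero, zero_add] at hmem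
    exact v.2 (by exact_mod_cast Int.eq_one_of_dvd_one (by positivity) hmem)
  have := Finite.of_injective _ hinj
  exact Set.toFinite _

theorem index_dvdSubgroup (h : {u | a u ≠ 1}.Finite) :
    (dvdSubgroup a).index = ∏ᶠ u, a u := by
  classical
  have := h.fintype
  let φ : (U →₀ ℤ) →+ ∀ u : {u | a u ≠ 1}, ZMod (a u) :=
    AddMonoidHom.mk' (fun n u => (n u.1 : ZMod (a u))) fun n n' => by
      funext u
      simp
  have hker : φ.ker = dvdSubgroup a := by
    ext n
    constructor
    · intro hn u
      by_cases hu : a u = 1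
      · rw [hu]
        exact one_dvd _
      · exact (ZMod.intCast_zmod_eq_zero_iff_dvd _ _).1 (congrFun hn ⟨u, hu⟩)
    · intro hn
      exact funext fun u => (ZMod.intCast_zmod_eq_zero_iff_dvd _ _).2 (hn u.1)
  have hsurj : Function.Surjective φ := by
    intro c
    choose n hn using fun u => ZMod.intCast_surjective (c u)
    refine ⟨(Finsupp.equivFunOnFinite.symm n).embDomain (.subtype _), funext fun u => ?_⟩
    rw [← hn u]
    exact congrArg _ (Finsupp.embDomain_apply_self _ _ u)
  rw [← hker, AddSubgroup.index_ker, AddMonoidHom.range_eq_top.2 hsurj,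
    Nat.card_congr AddSubgroup.topEquiv.toEquiv, Nat.card_pi]
  simp only [Nat.card_zmod]
  rw [finprod_eq_prod_of_mulSupport_subset (s := h.toFinset) _ (by
    intro u hu
    exact h.mem_toFinset.2 hu)]
  exact (Finset.prod_subtype h.toFinset (fun u => h.mem_toFinset) a).symm

end FinsuppIndex

namespace RayClass

namespace SModulus

open CategoryTheory groupCohomology

variable {k K : Type} [Field k] [Field K] [Algebra k K] {S : Set (Place k)} (m : SModulus S)

theorem inl_mem_union_support_induced_iff [Algebra.IsAlgebraic k K] (w : FinitePlace K) :
    Sum.inl w ∈ placesOver K S ∪ (m.induced K).support ↔ Sum.inl (w.under k) ∈ S ∪ m.support :=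
  or_congr w.inl_mem_placesOver (m.inl_mem_support_induced_iff w)

/-- The coefficient of an invariant divisor at a place. -/
def coeff (D : (m.divisorRep K).ρ.invariants) (w : FinitePlace K) : ℤ :=
  (D.1 : (m.induced K).divisorGroup).1 w

variable {m} in
theorem invariants_ext {D D' : (m.divisorRep K).ρ.invariants}
    (h : ∀ w, m.coeff D w = m.coeff D' w) : D = D' :=
  Subtype.ext (Subtype.ext (Finsupp.ext h))

theorem coeff_eq_zero [Algebra.IsAlgebraic k K] (D : (m.divisorRep K).ρ.invariants) {w : FinitePlace K}
    (hw : Sum.inl (w.under k) ∈ S ∪ m.support) : m.coeff D w = 0 :=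
  (D.1 : (m.induced K).divisorGroup).2 w ((m.inl_mem_union_support_induced_iff w).2 hw)

variable [FiniteDimensional k K] [IsGalois k K]

variable (K) in
/-- The invariant divisor `∑_w a(v) n(v) w` of `K`, where `v` is the place of `k` under `w`. -/
def pullback (a : FinitePlace k → ℤ) :
    (m.unramifiedPart K).divisorGroup →+ (m.divisorRep K).ρ.invariants where
  toFun n := ⟨(⟨Finsupp.ofSupportFinite (fun w => a (w.under k) * n.1 (w.under k))
      ((n.1.hasFiniteSupport.biUnion fun v _ =>
        FinitePlace.finite_setOf_under_eq (K := K) v).subset fun w hw =>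
          Set.mem_biUnion (x := w.under k) (right_ne_zero_of_mul hw) rfl),
      fun w hw => (mul_eq_zero_of_right _
        (n.2 _ ((m.inl_mem_union_support_induced_iff w).1 hw)))⟩ : (m.induced K).divisorGroup),
    fun σ => Subtype.ext (Finsupp.ext fun w => by
      refine (m.smul_divisor_apply σ _ w).trans ?_
      change a ((σ⁻¹ • w).under k) * n.1 ((σ⁻¹ • w).under k) = a (w.under k) * n.1 (w.under k)
      rw [FinitePlace.under_smul])⟩
  map_zero' := Subtype.ext (Subtype.ext (Finsupp.ext fun w => mul_zero _))
  map_add' n n' := Subtype.ext (Subtype.ext (Finsupp.ext fun w => mul_add _ _ _))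

theorem pullback_coeff (a : FinitePlace k → ℤ) (n : (m.unramifiedPart K).divisorGroup)
    (w : FinitePlace K) :
    m.coeff (m.pullback K a n) w = a (w.under k) * n.1 (w.under k) := rfl

theorem coeff_eq_of_under_eq (D : (m.divisorRep K).ρ.invariants) {w w' : FinitePlace K}
    (h : w.under k = w'.under k) : m.coeff D w = m.coeff D w' := by
  obtain ⟨σ, rfl⟩ := FinitePlace.exists_smul_eq_of_under_eq h
  let D₁ : (m.induced K).divisorGroup := D.1
  have h1 := m.smul_divisor_apply σ D₁ (σ • w)
  rw [inv_smul_smul] at h1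
  have h2 : σ • D₁ = D₁ := D.2 σ
  rw [h2] at h1
  exact h1.symm

variable (K) in
/-- The ramification indices of the places outside `S ∪ S(𝔪)`. -/
def ramificationFamily (v : {v : FinitePlace k // Sum.inl v ∉ S ∪ m.support}) : ℕ :=
  ramificationIndex K v.1

variable (K) in
theorem index_range_pullback :
    (m.pullback K fun v => ramificationIndex K v).range.index =
      (dvdSubgroup (m.ramificationFamily K)).index := by
  classical
  let U := {v : FinitePlace k // Sum.inl v ∉ S ∪ m.support}
  choose s hs using FinitePlace.exists_under_eq (k := k) (K := K)
  have hs_inj : Function.Injective s := fun v v' h => by rw [← hs v, h, hs v']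
  have hsU : Function.Injective fun v : U => s v.1 := hs_inj.comp Subtype.val_injective
  let ev : (m.divisorRep K).ρ.invariants →+ (U →₀ ℤ) := AddMonoidHom.mk'
    (fun D => (D.1 : (m.induced K).divisorGroup).1.comapDomain (fun v : U => s v.1) hsU.injOn)
    fun D D' => Finsupp.ext fun v => rfl
  have hev : ∀ D (v : U), ev D v = m.coeff D (s v.1) := fun D v => rfl
  have hsurj : Function.Surjective ev := by
    intro n
    refine ⟨m.pullback K (fun _ => 1) ⟨n.embDomain (.subtype _), fun v hv => ?_⟩, ?_⟩
    · refine Finsupp.embDomain_of_notMem_range _ _ _ ?_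
      rintro ⟨u, rfl⟩
      exact u.2 hv
    · ext v
      rw [hev, pullback_coeff, one_mul, hs]
      exact Finsupp.embDomain_apply_self _ _ v
  rw [← AddSubgroup.index_comap_of_surjective _ hsurj]
  congr 1
  ext D
  constructor
  · rintro ⟨n, rfl⟩ v
    rw [hev, pullback_coeff, hs]
    exact dvd_mul_right _ _
  · intro hD
    refine ⟨⟨Finsupp.ofSupportFinite (fun v => m.coeff D (s v) / ramificationIndex K v)
      (((D.1 : (m.induced K).divisorGroup).1.hasFiniteSupport.preimage hs_inj.injOn).subset
        fun v hv h => hv ?_), fun v hv => ?_⟩, invariants_ext fun w => ?_⟩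
    · change m.coeff D (s v) / _ = 0
      rw [show m.coeff D (s v) = 0 from h, Int.zero_ediv]
    · change m.coeff D (s v) / _ = 0
      rw [m.coeff_eq_zero D (by rwa [hs]), Int.zero_ediv]
    · rw [pullback_coeff]
      change (ramificationIndex K (w.under k) : ℤ) *
        (m.coeff D (s (w.under k)) / ramificationIndex K (w.under k)) = _
      rw [m.coeff_eq_of_under_eq D (hs (w.under k))]
      by_cases hw : Sum.inl (w.under k) ∈ S ∪ m.support
      · rw [m.coeff_eq_zero D hw, Int.zero_ediv, mul_zero]
      · refine Int.mul_ediv_cancel' ?_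
        have := hD ⟨w.under k, hw⟩
        rwa [hev, m.coeff_eq_of_under_eq D (hs (w.under k))] at this

theorem pullback_injective :
    Function.Injective (m.pullback K fun v => ramificationIndex K v) := by
  intro n n' h
  refine Subtype.ext (Finsupp.ext fun v => ?_)
  obtain ⟨w, rfl⟩ := FinitePlace.exists_under_eq (K := K) v
  have := congrArg (m.coeff · w) h
  simp only [pullback_coeff] at this
  exact mul_left_cancel₀ (Nat.cast_ne_zero.2 (FinitePlace.ramificationIndex_pos _).ne') this

theorem exists_units_map_eq {x : Kˣ} (h : ∀ σ : K ≃ₐ[k] K, σ • x = x) :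
    ∃ y : kˣ, Units.map (algebraMap k K : k →* K) y = x := by
  obtain ⟨y, hy⟩ := (IsGalois.mem_range_algebraMap_iff_fixed (F := k) (x : K)).2
    fun σ => congrArg Units.val (h σ)
  have hy0 : y ≠ 0 := by
    rintro rfl
    rw [map_zero] at hy
    exact x.ne_zero hy.symm
  exact ⟨Units.mk0 y hy0, Units.ext hy⟩

theorem map_principalDivisors_eq (hk : IsGlobalField k) (hK : IsGlobalField K) :
    (m.unramifiedPart K).principalDivisors.map (m.pullback K fun v => ramificationIndex K v) =
      (LinearMap.range (Rep.mapInvariants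
        (m.divRepHom hK ≫ m.principalInclusion K))).toAddSubgroup := by
  ext D
  have key : ∀ (n : (m.unramifiedPart K).divisorGroup) (x : kˣ) (b : (m.induced K).rayGroup),
      Units.map (algebraMap k K : k →* K) x = b →
      (∀ v : FinitePlace k, Sum.inl v ∉ S → n.1 v = v.ord x) →
      ∀ w, m.coeff (m.pullback K (fun v => ramificationIndex K v) n) w =
        ((m.induced K).divHom hK (Additive.ofMul b)).1.1 w := by
    intro n x b hx hn w
    by_cases hw : Sum.inl w ∈ placesOver K S
    · rw [((m.induced K).divHom hK _).1.2 w (Or.inl hw)]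
      exact m.coeff_eq_zero _ (Or.inl (w.inl_mem_placesOver.1 hw))
    · rw [divHom_apply_of_notMem _ _ _ hw, pullback_coeff,
        hn _ (w.inl_mem_placesOver.not.1 hw), FinitePlace.ramificationIndex_eq,
        ← FinitePlace.ord_map, hx]
      rfl
  constructor
  · rintro ⟨n, ⟨x, hx, hn⟩, rfl⟩
    refine ⟨⟨show Additive (m.induced K).rayGroup from
      Additive.ofMul ⟨_, (m.map_mem_rayGroup_iff x).2 hx⟩, fun σ => ?_⟩, ?_⟩
    · exact Additive.toMul.injective (Subtype.ext (Units.ext (σ.commutes _)))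
    · exact invariants_ext fun w => (key n x ⟨_, (m.map_mem_rayGroup_iff x).2 hx⟩ rfl hn w).symm
  · rintro ⟨⟨b, hb⟩, rfl⟩
    let b' : (m.induced K).rayGroup := Additive.toMul (b : Additive (m.induced K).rayGroup)
    obtain ⟨y, hy⟩ := exists_units_map_eq (k := k) (x := b'.1) fun σ =>
      congrArg (fun z : (m.induced K).rayGroup => z.1) (hb σ)
    have hyr : y ∈ (m.unramifiedPart K).rayGroup := by
      rw [← m.map_mem_rayGroup_iff, hy]
      exact b'.2
    let n := (m.unramifiedPart K).divHom hk (Additive.ofMul ⟨y, hyr⟩)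
    refine ⟨n.1, n.2, invariants_ext fun w => ?_⟩
    exact key n.1 y b' hy (fun v hv => divHom_apply_of_notMem _ _ _ hv) w

theorem index_principal_invariants (hk : IsGlobalField k) (hK : IsGlobalField K) :
    (LinearMap.range (Rep.mapInvariants
        (m.divRepHom hK ≫ m.principalInclusion K))).toAddSubgroup.index =
      Nat.card (m.unramifiedPart K).ClassGroup *
        (dvdSubgroup (m.ramificationFamily K)).index := by
  rw [← m.map_principalDivisors_eq hk hK, ← AddSubgroup.relIndex_mul_index
      (K := (m.pullback K fun v => ramificationIndex K v).range) (AddSubgroup.map_le_range _ _),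
    AddMonoidHom.range_eq_map, AddSubgroup.relIndex_map_map_of_injective _ _ m.pullback_injective,
    AddSubgroup.relIndex_top_right, ← AddMonoidHom.range_eq_map, index_range_pullback]
  rfl

theorem finite_fixedPoints_formula (hk : IsGlobalField k) (hK : IsGlobalField K)
    [Finite (m.induced K).ClassGroup] [Finite (H1 (m.unitRep K))] [Finite (H2 (m.unitRep K))] :
    {v | m.ramificationFamily K v ≠ 1}.Finite ∧
    Nat.card (FixedPoints.addSubgroup (K ≃ₐ[k] K) (m.induced K).ClassGroup) *
        Nat.card (H1 (m.unitRep K)) * Nat.card (LinearMap.range (m.H2Map K).hom) =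
      Nat.card (m.unramifiedPart K).ClassGroup * (∏ᶠ v, m.ramificationFamily K v) *
        Nat.card (H2 (m.unitRep K)) * Nat.card (H1 (m.rayRep K)) := by
  have := m.subsingleton_H1_divisorRep (K := K)
  have hX := m.unitSequence_shortExact hK
  have hY := m.classSequence_shortExact K
  have hindex := m.index_principal_invariants hk hK
  have hne : Nat.card (m.unramifiedPart K).ClassGroup *
      (dvdSubgroup (m.ramificationFamily K)).index ≠ 0 := by
    rw [← hindex, index_range_invariants hX hY]
    have : Finite (m.classRep K) := inferInstanceAs (Finite (m.induced K).ClassGroup)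
    exact mul_ne_zero Nat.card_pos.ne' Nat.card_pos.ne'
  have hT := finite_setOf_ne_one_of_index_dvdSubgroup _ (right_ne_zero_of_mul hne)
  refine ⟨hT, ?_⟩
  rw [← index_dvdSubgroup _ hT, ← hindex]
  exact card_invariants_mul_eq hX hY

end SModulus

end RayClass

open RayClass in
theorem theorem4p1 {k K : Type} [Field k] [Field K] [Algebra k K]
    (hk : IsGlobalField k) [FiniteDimensional k K] [IsGalois k K]
    (S : Set (Place k)) (hS_finite : S.Finite) (hS_nonempty : S.Nonempty)
    (hS_inf : ∀ v : NumberField.InfinitePlace k, Sum.inr v ∈ S)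
    (m : SModulus S) :
    Finite (m.induced K).ClassGroup ∧
    Finite (m.unramifiedPart K).ClassGroup ∧
    Finite (groupCohomology.H1 (m.unitRep K)) ∧
    Finite (groupCohomology.H2 (m.unitRep K)) ∧
    Finite (groupCohomology.H1 (m.rayRep K)) ∧
    {v : FinitePlace k | Sum.inl v ∉ S ∪ m.support ∧ ramificationIndex K v ≠ 1}.Finite ∧
    (Nat.card (FixedPoints.addSubgroup (K ≃ₐ[k] K) (m.induced K).ClassGroup) : ℚ) /
        (Nat.card (m.unramifiedPart K).ClassGroup : ℚ) =
      (Nat.card (groupCohomology.H2 (m.unitRep K)) : ℚ) /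
          (Nat.card (groupCohomology.H1 (m.unitRep K)) : ℚ) *
        (((∏ᶠ (v : FinitePlace k) (_ : Sum.inl v ∉ S ∪ m.support), ramificationIndex K v : ℕ) : ℚ) *
            (Nat.card (groupCohomology.H1 (m.rayRep K)) : ℚ) /
          (Nat.card (LinearMap.range (m.H2Map K).hom) : ℚ)) := by
  have hK : IsGlobalField K := IsGlobalField.of_finiteDimensional hk
  have := hK.finite_infinitePlace
  have hSK : (placesOver K S).Nonempty := placesOver_nonempty hS_nonempty
  have hfg := m.fg_unitRep hK (placesOver_finite hS_finite)
  have hCl := (m.induced K).finite_classGroup hK hSK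
  have hClk := (m.unramifiedPart K).finite_classGroup hk hS_nonempty
  have hH1 := finite_H1_of_fg (m.unitRep K) hfg
  have hH2 := finite_H2_of_fg (m.unitRep K) hfg
  have hH1r := m.finite_H1_rayRep hK hSK
  obtain ⟨hT, h⟩ := m.finite_fixedPoints_formula hk hK
  refine ⟨hCl, hClk, hH1, hH2, hH1r,
    (hT.image Subtype.val).subset fun v hv => ⟨⟨v, hv.1⟩, hv.2, rfl⟩, ?_⟩
  have : Finite (LinearMap.range (m.H2Map K).hom) :=
    Finite.of_surjective _ (m.H2Map K).hom.surjective_rangeRestrict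
  have h1 : (Nat.card (m.unramifiedPart K).ClassGroup : ℚ) ≠ 0 :=
    Nat.cast_ne_zero.2 Nat.card_pos.ne'
  have h2 : (Nat.card (groupCohomology.H1 (m.unitRep K)) : ℚ) ≠ 0 :=
    Nat.cast_ne_zero.2 Nat.card_pos.ne'
  have h3 : (Nat.card (LinearMap.range (m.H2Map K).hom) : ℚ) ≠ 0 :=
    Nat.cast_ne_zero.2 Nat.card_pos.ne'
  have hprod : ∏ᶠ v, m.ramificationFamily K v =
      ∏ᶠ (v : FinitePlace k) (_ : Sum.inl v ∉ S ∪ m.support), ramificationIndex K v :=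
    finprod_subtype_eq_finprod_cond _
  rw [← hprod, div_mul_div_comm, div_eq_div_iff h1 (mul_ne_zero h2 h3), ← mul_assoc]
  have h' := congrArg (Nat.cast : ℕ → ℚ) h
  push_cast at h' ⊢
  rw [h']
  ring
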